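/- For a finite set $\mathcal S\subset\{-1,0,1\}^2\setminus\{(0,0)\}$ of small steps, let $q(i,j;n)$ be the number of $n$-step walks that start at $(0,0)$, take their steps from $\mathcal S$, stay in the quadrant $\{i\ge 0,\ j\ge 0\}$ and end at $(i,j)$, and let $Q(x,y;t)=\sum_{i,j,n\ge0}q(i,j;n)x^iy^jt^n$. Write $\bar x=1/x$, $\bar y=1/y$, identify a step $(i,j)$ with the monomial $x^iy^j$, and put $$S(x,y)=\sum_{(i,j)\in\mathcal S}x^iy^j=\sum_{k=-1}^{1}A_k(x)y^k=\sum_{k=-1}^{1}B_k(y)x^k,\qquad K(x,y;t)=1-tS(x,y).$$ Let $G$ be the group of birational transformations generated by the involutions $$\Phi:(x,y)\mapsto\Bigl(\bar x\,\frac{B_{-1}(y)}{B_1(y)},\,y\Bigr),\qquad \Psi:(x,y)\mapsto\Bigl(x,\,\bar y\,\frac{A_{-1}(x)}{A_1(x)}\Bigr),$$ acting on rational functions by $g(A(x,y))=A(g(x,y))$; $\mathrm{sign}(g)$ is $1$ if $g$ is a product of an even number of generators $\Phi,\Psi$, and $-1$ if it is a product of an odd number. For a series $F$ in $t$ whose coefficients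 are Laurent polynomials in $y$ (resp. $x$), $[y^>]F$ (resp. $[x^>]F$) is the sum of its terms with positive exponent of $y$ (resp. $x$). The 23 models associated with a finite group are, with the compass notation $N=(0,1)$, $E=(1,0)$, $NE=(1,1)$, etc., the following. * Group of order 4 (16 models): $\{N,E,S,W\}$, $\{NE,SE,SW,NW\}$, $\{N,NE,SE,S,SW,NW\}$, $\{N,NE,E,SE,S,SW,W,NW\}$, $\{NE,S,NW\}$, $\{NE,E,S,W,NW\}$, $\{N,NE,S,NW\}$, $\{N,NE,E,S,W,NW\}$, $\{N,NE,SE,SW,NW\}$, $\{N,NE,E,SE,SW,W,NW\}$, $\{N,SE,S,SW\}$, $\{N,E,SE,S,SW,W\}$, $\{NE,SE,S,SW,NW\}$, $\{NE,E,SE,S,SW,W,NW\}$, $\{N,SE,SW\}$, $\{N,E,SE,SW,W\}$. * Group of order 6 (5 models): $\{N,SE,W\}$, $\{N,E,SE,S,W,NW\}$, $\{W,S,NE\}$ (Kreweras), $\{E,N,SW\}$ (reverse Kreweras), $\{E,N,W,S,NE,SW\}$ (double Kreweras). * Group of order 8 (2 models): $\{E,SE,W,NW\}$, $\{E,W,NE,SW\}$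 (Gessel). **Proposition.** Let $\mathcal S$ be one of these 23 models other than the Kreweras, reverse Kreweras, double Kreweras and Gessel models. Then $G$ is finite, and the following holds. The rational function $$R(x,y;t)=\frac1{K(x,y;t)}\sum_{g\in G}\mathrm{sign}(g)\,g(xy)$$ is a power series in $t$ with coefficients in $\mathbb Q(x)[y,\bar y]$. Its positive part $R^+(x,y;t)=[y^>]R(x,y;t)$ is a power series in $t$ with coefficients in $\mathbb Q[x,\bar x,y]$, and $[x^>]R^+(x,y;t)=xy\,Q(x,y;t)$. In brief, $$xy\,Q(x,y;t)=[x^>][y^>]R(x,y;t).$$ In particular, $Q(x,y;t)$ is D-finite: the vector space over $\mathbb Q(x,y,t)$ spanned by all its partial derivatives of all orders in $x,y,t$ has finite dimension. Moreover, for all $i,j,n\ge0$, $$q(i,j;n)=[x^{i+1}y^{j+1}]\Bigl(\sum_{g\in G}\mathrm{sign}(g)\,g(xy)\Bigr)S(x,y)^n,$$ where one first takes the coefficient of $y^{j+1}$ in this element of $\mathbb Q(x)[y,\bar y]$, which is a Laurent polynomial in $x$, and then its coefficient of $x^{i+1}$. -/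

import Mathlib

noncomputable section

namespace QuarterPlane

/-! ### Step sets -/

/-- The compass names of the eight small steps. -/
def N : ℤ × ℤ := (0, 1)
def NE : ℤ × ℤ := (1, 1)
def E : ℤ × ℤ := (1, 0)
def SE : ℤ × ℤ := (1, -1)
def S : ℤ × ℤ := (0, -1)
def SW : ℤ × ℤ := (-1, -1)
def W : ℤ × ℤ := (-1, 0)
def NW : ℤ × ℤ := (-1, 1)

/-- The 16 models whose group has order 4 (all of them have a vertical symmetry). -/
def modelsD2 : Finset (Finset (ℤ × ℤ)) :=
  { {N, E, S, W}, {NE, SE, SW, NW}, {N, NE, SE, S, SW, NW}, {N, NE, E, SE, S, SW, W, NW},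
    {NE, S, NW}, {NE, E, S, W, NW},
    {N, NE, S, NW}, {N, NE, E, S, W, NW},
    {N, NE, SE, SW, NW}, {N, NE, E, SE, SW, W, NW},
    {N, SE, S, SW}, {N, E, SE, S, SW, W},
    {NE, SE, S, SW, NW}, {NE, E, SE, S, SW, W, NW},
    {N, SE, SW}, {N, E, SE, SW, W} }

def kreweras : Finset (ℤ × ℤ) := {W, S, NE}
def reverseKreweras : Finset (ℤ × ℤ) := {E, N, SW}
def doubleKreweras : Finset (ℤ × ℤ) := {E, N, W, S, NE, SW}
def gessel : Finset (ℤ × ℤ) := {E, W, NE, SW}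

/-- The 5 models whose group has order 6. -/
def modelsD3 : Finset (Finset (ℤ × ℤ)) :=
  { {N, SE, W}, {N, E, SE, S, W, NW}, kreweras, reverseKreweras, doubleKreweras }

/-- The 2 models whose group has order 8. -/
def modelsD4 : Finset (Finset (ℤ × ℤ)) := { {E, SE, W, NW}, gessel }

/-- The 23 models associated with a finite group. -/
def finiteGroupModels : Finset (Finset (ℤ × ℤ)) := modelsD2 ∪ modelsD3 ∪ modelsD4

/-! ### Quarter plane walks -/

/-- The `n`-step walks with steps in `𝒮` that start at the origin and stay in the quadrant
(every prefix ends at a point with non-negative coordinates). -/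
def walks (𝒮 : Finset (ℤ × ℤ)) (n : ℕ) : Finset (Fin n → ℤ × ℤ) :=
  {w ∈ Fintype.piFinset fun _ => 𝒮 |
    ∀ m : Fin (n + 1), (0 : ℤ × ℤ) ≤ ∑ k : Fin n with k.val < m.val, w k}

/-- `q 𝒮 i j n` is the number of `n`-step quarter plane walks ending at `(i, j)`. -/
def q (𝒮 : Finset (ℤ × ℤ)) (i j n : ℕ) : ℕ :=
  ({w ∈ walks 𝒮 n | ∑ k, w k = ((i : ℤ), (j : ℤ))} : Finset (Fin n → ℤ × ℤ)).card

/-- The generating function `Q(x, y; t)` as an element of `ℚ[[x, y, t]]`; the variables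
`x, y, t` are numbered `0, 1, 2`. -/
def Q (𝒮 : Finset (ℤ × ℤ)) : MvPowerSeries (Fin 3) ℚ :=
  fun m => (q 𝒮 (m 0) (m 1) (m 2) : ℚ)

/-! ### Rational functions and Laurent polynomials -/

/-- The field `ℚ(x)`. -/
abbrev Qx : Type := RatFunc ℚ

/-- The field `ℚ(x, y) = ℚ(x)(y)`. -/
abbrev Qxy : Type := RatFunc Qx

/-- The field `ℚ(x, y, t) = ℚ(x, y)(t)`. -/
abbrev Qxyt : Type := RatFunc Qxy

/-- The ring `ℚ[x, x⁻¹]`. -/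
abbrev LaurentX : Type := LaurentPolynomial ℚ

/-- The ring `ℚ(x)[y, y⁻¹]`. -/
abbrev LaurentY : Type := LaurentPolynomial Qx

/-- The ring `ℚ[x, x⁻¹, y] = ℚ[x, x⁻¹][y]`. -/
abbrev LaurentXPolyY : Type := Polynomial LaurentX

def x : Qxy := RatFunc.C RatFunc.X
def y : Qxy := RatFunc.X

/-- The inclusion `ℚ[x, x⁻¹] → ℚ(x)`. -/
def laurentXToQx : LaurentX →+* Qx :=
  LaurentPolynomial.eval₂ RatFunc.C (Units.mk0 RatFunc.X RatFunc.X_ne_zero)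

/-- The inclusion `ℚ(x)[y, y⁻¹] → ℚ(x, y)`. -/
def laurentYToQxy : LaurentY →+* Qxy :=
  LaurentPolynomial.eval₂ RatFunc.C (Units.mk0 RatFunc.X RatFunc.X_ne_zero)

/-- The inclusion `ℚ[x, x⁻¹, y] → ℚ(x)[y, y⁻¹]`. -/
def polyYToLaurentY : LaurentXPolyY →+* LaurentY :=
  Polynomial.toLaurent.comp (Polynomial.mapRingHom laurentXToQx)

/-- `F` is the expansion of the rational function `R ∈ ℚ(x, y, t)` as a power series in `t` with
coefficients in `ℚ(x)[y, y⁻¹]` (an identity of Laurent series in `t` over `ℚ(x, y)`). -/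
def IsExpansion (R : Qxyt) (F : PowerSeries LaurentY) : Prop :=
  (R : LaurentSeries Qxy) = ((PowerSeries.map laurentYToQxy F : PowerSeries Qxy) : LaurentSeries Qxy)

/-- The positive part of a Laurent polynomial: keep the terms of positive exponent. -/
def posPart {A : Type*} [Semiring A] (f : LaurentPolynomial A) : LaurentPolynomial A :=
  ∑ k ∈ f.coeff.support with 0 < k, LaurentPolynomial.C (f.coeff k) * LaurentPolynomial.T k

/-- `[y^>] F(x, y; t)`, taken in each coefficient of the power series in `t`. -/
def posPartY (F : PowerSeries LaurentY) : PowerSeries LaurentY :=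
  PowerSeries.mk fun n => posPart (PowerSeries.coeff n F)

/-- `[x^>] F(x, y; t)`, taken in each coefficient of `y ^ j * t ^ n`. -/
def posPartX (F : PowerSeries LaurentXPolyY) : PowerSeries LaurentXPolyY :=
  PowerSeries.mk fun n =>
    (PowerSeries.coeff n F).sum fun j a => Polynomial.monomial j (posPart a)

/-- The coefficient `[x ^ i * y ^ j] f` of `f ∈ ℚ(x)[y, y⁻¹]` (as an element of `ℚ(x, y)`): first
the coefficient of `y ^ j`, an element of `ℚ(x)`, then its coefficient of `x ^ i`. Both are read in
Laurent series, which contain the Laurent polynomials. -/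
def coeffXY (i j : ℤ) (f : Qxy) : ℚ :=
  (((f : LaurentSeries Qx).coeff j : Qx) : LaurentSeries ℚ).coeff i

/-- The generating function `Q(x, y; t)` as a power series in `t` with coefficients in
`ℚ[x, y] ⊆ ℚ[x, x⁻¹, y]`. All steps are small, so that a walk of length `n` ends at a point
`(i, j)` with `i, j ≤ n`. -/
def Qt (𝒮 : Finset (ℤ × ℤ)) : PowerSeries LaurentXPolyY :=
  PowerSeries.mk fun n => ∑ i ∈ Finset.range (n + 1), ∑ j ∈ Finset.range (n + 1),
    Polynomial.monomial j (LaurentPolynomial.C (q 𝒮 i j n : ℚ) * LaurentPolynomial.T (i : ℤ))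

/-- The series `x * y * Q(x, y; t)`. -/
def xyQ (𝒮 : Finset (ℤ × ℤ)) : PowerSeries LaurentXPolyY :=
  PowerSeries.C (Polynomial.monomial 1 (LaurentPolynomial.T 1)) * Qt 𝒮

/-! ### The group of the walk -/

/-- The step polynomial `S(x, y)`. -/
def stepPoly (𝒮 : Finset (ℤ × ℤ)) : Qxy := ∑ s ∈ 𝒮, x ^ s.1 * y ^ s.2

/-- The coefficient `A_k(x)` of `y ^ k` in `S(x, y)`. -/
def A (𝒮 : Finset (ℤ × ℤ)) (k : ℤ) : Qxy := ∑ s ∈ 𝒮 with s.2 = k, x ^ s.1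

/-- The coefficient `B_k(y)` of `x ^ k` in `S(x, y)`. -/
def B (𝒮 : Finset (ℤ × ℤ)) (k : ℤ) : Qxy := ∑ s ∈ 𝒮 with s.1 = k, y ^ s.2

/-- A birational transformation `g` of the plane is represented by the automorphism
`f(x, y) ↦ f(g(x, y))` of the field `ℚ(x, y)`; it is determined by the images of `x` and `y`.
`IsPhi 𝒮 g` says that `g` is `Φ : (x, y) ↦ (x⁻¹ * B₋₁(y) / B₁(y), y)`. -/
def IsPhi (𝒮 : Finset (ℤ × ℤ)) (g : RingAut Qxy) : Prop :=
  g x = x⁻¹ * (B 𝒮 (-1) / B 𝒮 1) ∧ g y = y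

/-- `IsPsi 𝒮 g` says that `g` is `Ψ : (x, y) ↦ (x, y⁻¹ * A₋₁(x) / A₁(x))`. -/
def IsPsi (𝒮 : Finset (ℤ × ℤ)) (g : RingAut Qxy) : Prop :=
  g x = x ∧ g y = y⁻¹ * (A 𝒮 (-1) / A 𝒮 1)

/-- The set `{Φ, Ψ}`. -/
def generators (𝒮 : Finset (ℤ × ℤ)) : Set (RingAut Qxy) := {g | IsPhi 𝒮 g ∨ IsPsi 𝒮 g}

/-- The group `G(𝒮)` generated by `Φ` and `Ψ`. -/
def group (𝒮 : Finset (ℤ × ℤ)) : Subgroup (RingAut Qxy) := Subgroup.closure (generators 𝒮)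

open Classical in
/-- The sign of `g`: it is `1` if `g` is the product of an even number of generators, and `-1`
otherwise. -/
def sign (𝒮 : Finset (ℤ × ℤ)) (g : RingAut Qxy) : ℤ :=
  if ∃ l : List (RingAut Qxy), (∀ h ∈ l, h ∈ generators 𝒮) ∧ Even l.length ∧ l.prod = g
  then 1 else -1

/-- The orbit sum `∑ g ∈ G(𝒮), sign(g) * g(x * y)` (for a finite group). -/
def orbitSum (𝒮 : Finset (ℤ × ℤ)) : Qxy :=
  ∑ᶠ g : group 𝒮, (sign 𝒮 (g : RingAut Qxy) : Qxy) * (g : RingAut Qxy) (x * y)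

/-- The kernel `K(x, y; t) = 1 - t * S(x, y)`. -/
def kernel (𝒮 : Finset (ℤ × ℤ)) : Qxyt := 1 - RatFunc.X * RatFunc.C (stepPoly 𝒮)

/-- The rational function `R(x, y; t)`. -/
def R (𝒮 : Finset (ℤ × ℤ)) : Qxyt := 1 / kernel 𝒮 * RatFunc.C (orbitSum 𝒮)

/-! ### D-finite series -/

/-- A power series `F ∈ K[[x_i : i ∈ σ]]` is D-finite if the vector space over `K(x_i : i ∈ σ)`
spanned by all its iterated partial derivatives (in the fraction field of `K[[x_i : i ∈ σ]]`)
has finite dimension. -/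
def IsDFinite {σ K : Type*} [Field K] (F : MvPowerSeries σ K) : Prop :=
  FiniteDimensional
    (IntermediateField.adjoin K (Set.range fun i : σ =>
      algebraMap (MvPowerSeries σ K) (FractionRing (MvPowerSeries σ K)) (MvPowerSeries.X i)))
    (Submodule.span
      (IntermediateField.adjoin K (Set.range fun i : σ =>
        algebraMap (MvPowerSeries σ K) (FractionRing (MvPowerSeries σ K)) (MvPowerSeries.X i)))
      (Set.range fun l : List σ =>
        algebraMap (MvPowerSeries σ K) (FractionRing (MvPowerSeries σ K))
          (l.foldr (fun i G => MvPowerSeries.pderiv K i G) F)))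

end QuarterPlane

end

/-! The coefficient formula is a double reflection argument. Shift the walks by `(1,1)`, so that
`xyQ` counts walks in `i, j ≥ 1` and the forbidden boundary lies on the axes. Let `O` be the orbit
sum and `α = A₋₁/A₁`. The step polynomial `S` is invariant under `y ↦ α/y` and `O` is antisymmetric,
so every `O * S^n` is antisymmetric and has no term in `y^0`. As steps are small, its coefficients
of positive `y`-exponent obey the recurrence of walks confined to `j ≥ 1`, started with signed
weights at the monomials of `O` in that half-plane. Hence they are Laurent polynomials in `x`, even
when `α` is not (`coeff_mul_stepLaurent_pow`).

Next, these signed half-plane weights vanish on the axis `i = 0`. With a vertical symmetry,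
reflection in that axis preserves the half-plane and reverses the signs. In the other three models
both `Φ` and `Ψ` act linearly on exponents; the half-plane weights are the restriction of weights on
the whole plane, which are antisymmetric under both (`walkWeight_axis_of_symm`). So the part with
`i, j ≥ 1` obeys the quadrant recurrence. The only monomial of `O` there is `xy`, so this part
counts quadrant walks (`coeff_halfPlanePoly_eq_q`). The positive-part statement is a repackaging of
this, with `1/K` expanded as a geometric series.

The group is generated by two involutions, hence dihedral once the order of `ΦΨ` is known (2, 3 or
4). Rotations and reflections are disjoint, which makes the sign well defined and the orbit sum
explicit (`finsum_wordSign`).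

For D-finiteness, the coefficient formula exhibits `Q(u,v;t)` as the residue in `x` and `y` of the
rational function `O x⁻² y⁻² / ((1 - u/x)(1 - v/y)(1 - tS))`. The argument of Lipshitz applies:
among operators in `u, v, t, ∂x, ∂y` and one of `∂u, ∂v, ∂t`, about `N^6` monomials of size `N` act
on this function, with images in a space of dimension `O(N^5)`, so some nonzero operator kills it
(`exists_operator`). Extracting a suitable coefficient removes `∂x` and `∂y` (`isDFinite_lcoeff`).
This gives a linear differential equation in each variable, which suffices (`isDFinite_of_ode`). -/

noncomputable section
namespace QuarterPlane

/-! ### D-finiteness from one differential equation per variable -/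

section DFinite

variable {σ K : Type*} [Field K]

/-- The iterated partial derivative of `F` along a list of variables. -/
def iterPderiv (F : MvPowerSeries σ K) (l : List σ) : MvPowerSeries σ K :=
  l.foldr (fun i G => MvPowerSeries.pderiv K i G) F

@[simp] theorem iterPderiv_cons (F : MvPowerSeries σ K) (i : σ) (l : List σ) :
    iterPderiv F (i :: l) = MvPowerSeries.pderiv K i (iterPderiv F l) := rfl

theorem pderiv_comm (F : MvPowerSeries σ K) (i j : σ) :
    MvPowerSeries.pderiv K i (MvPowerSeries.pderiv K j F) =
      MvPowerSeries.pderiv K j (MvPowerSeries.pderiv K i F) := by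
  classical
  ext d
  simp only [MvPowerSeries.coeff_pderiv]
  rcases eq_or_ne i j with rfl | h
  · rfl
  · rw [add_right_comm]
    simp [h, h.symm]
    ring

theorem iterPderiv_perm (F : MvPowerSeries σ K) {l l' : List σ} (h : l.Perm l') :
    iterPderiv F l = iterPderiv F l' := by
  have : LeftCommutative (fun (i : σ) (G : MvPowerSeries σ K) => MvPowerSeries.pderiv K i G) :=
    ⟨fun i j G => pderiv_comm G i j⟩
  exact h.foldr_eq F

theorem iterPderiv_append (F : MvPowerSeries σ K) (l l' : List σ) :
    iterPderiv F (l ++ l') = iterPderiv (iterPderiv F l') l := by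
  simp [iterPderiv]

theorem iterPderiv_replicate (F : MvPowerSeries σ K) (i : σ) (n : ℕ) :
    iterPderiv F (List.replicate n i) = (MvPowerSeries.pderiv K i)^[n] F := by
  induction n with
  | zero => rfl
  | succ n ih => rw [List.replicate_succ, iterPderiv_cons, ih, Function.iterate_succ_apply']

/-- The module over the polynomial ring spanned by the derivatives of `F` of order less
than `n`. -/
def derivSpan (F : MvPowerSeries σ K) (n : ℕ) :
    Submodule (MvPolynomial σ K) (MvPowerSeries σ K) :=
  Submodule.span _ (iterPderiv F '' {l | l.length < n})

theorem derivSpan_mono (F : MvPowerSeries σ K) : Monotone (derivSpan F) := fun _ _ h =>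
  Submodule.span_mono (Set.image_mono fun _ hl => lt_of_lt_of_le hl h)

theorem iterPderiv_mem_derivSpan (F : MvPowerSeries σ K) {l : List σ} {n : ℕ}
    (h : l.length < n) : iterPderiv F l ∈ derivSpan F n :=
  Submodule.subset_span ⟨l, h, rfl⟩

theorem polynomial_smul_def (p : MvPolynomial σ K) (H : MvPowerSeries σ K) :
    p • H = (p : MvPowerSeries σ K) * H := by
  rw [Algebra.smul_def, MvPowerSeries.algebraMap_apply']
  simp

theorem pderiv_mem_derivSpan (F : MvPowerSeries σ K) (i : σ) {n : ℕ} {H : MvPowerSeries σ K}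
    (h : H ∈ derivSpan F n) : MvPowerSeries.pderiv K i H ∈ derivSpan F (n + 1) := by
  induction h using Submodule.span_induction with
  | mem H h =>
    obtain ⟨l, hl, rfl⟩ := h
    exact iterPderiv_mem_derivSpan F (l := i :: l) (by simpa using hl)
  | zero => simp
  | add H H' _ _ h h' => rw [map_add]; exact add_mem h h'
  | smul p H h' h =>
    rw [polynomial_smul_def, Derivation.leibniz, smul_eq_mul, ← polynomial_smul_def,
      MvPowerSeries.pderiv_coe, smul_eq_mul, mul_comm, ← polynomial_smul_def]
    exact add_mem (Submodule.smul_mem _ _ h)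
      (Submodule.smul_mem _ _ (derivSpan_mono F n.le_succ h'))

theorem iterPderiv_mem_derivSpan_add (F : MvPowerSeries σ K) (l : List σ) {n : ℕ}
    {H : MvPowerSeries σ K} (h : H ∈ derivSpan F n) :
    iterPderiv H l ∈ derivSpan F (n + l.length) := by
  induction l with
  | nil => exact h
  | cons i l ih => exact pderiv_mem_derivSpan F i ih

/-- By the Leibniz rule, every term in which some derivative hits `p` loses at least one order on
`F`; only the term subtracted here has full order. -/
theorem smul_iterPderiv_sub_mem (F : MvPowerSeries σ K) (p : MvPolynomial σ K) (m l : List σ) :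
    iterPderiv (p • iterPderiv F m) l - p • iterPderiv (iterPderiv F m) l ∈
      derivSpan F (m.length + l.length) := by
  induction l with
  | nil => simp [iterPderiv]
  | cons i l ih =>
    have h := pderiv_mem_derivSpan F i ih
    rw [map_sub, polynomial_smul_def p (iterPderiv (iterPderiv F m) l), Derivation.leibniz,
      smul_eq_mul, MvPowerSeries.pderiv_coe, smul_eq_mul, ← polynomial_smul_def] at h
    have h' : iterPderiv (iterPderiv F m) l * (MvPolynomial.pderiv i p : MvPolynomial σ K) ∈
        derivSpan F (m.length + (i :: l).length) := by
      rw [mul_comm, ← polynomial_smul_def, ← iterPderiv_append]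
      exact Submodule.smul_mem _ _ (iterPderiv_mem_derivSpan F (by simp; omega))
    have := add_mem h h'
    rwa [sub_add, add_sub_cancel_right] at this

/-- The multiplicative step of the closure argument: if the derivative of order `r` along `i`
is expressed by lower ones, so is every derivative that contains `i` at least `r` times. -/
theorem smul_iterPderiv_mem (F : MvPowerSeries σ K) (i : σ) (r : ℕ) (p : ℕ → MvPolynomial σ K)
    (h : ∑ k ∈ Finset.range (r + 1), p k • (MvPowerSeries.pderiv K i)^[k] F = 0)
    (l : List σ) :
    p r • iterPderiv F (l ++ List.replicate r i) ∈
      derivSpan F (l ++ List.replicate r i).length := by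
  have h1 : p r • iterPderiv F (List.replicate r i) ∈ derivSpan F r := by
    rw [Finset.sum_range_succ] at h
    rw [iterPderiv_replicate, eq_neg_of_add_eq_zero_right h]
    refine neg_mem (sum_mem fun k hk => Submodule.smul_mem _ _ ?_)
    rw [← iterPderiv_replicate]
    exact iterPderiv_mem_derivSpan F (by simpa using hk)
  have h2 := iterPderiv_mem_derivSpan_add F l h1
  have h3 := smul_iterPderiv_sub_mem F (p r) (List.replicate r i) l
  have := sub_mem h2 (by simpa using h3)
  rw [iterPderiv_append, List.length_append, List.length_replicate, add_comm]
  simpa using this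

/-- A power series that satisfies a linear differential equation with polynomial coefficients
in each variable is D-finite. -/
theorem isDFinite_of_ode [Fintype σ] (F : MvPowerSeries σ K)
    (h : ∀ i : σ, ∃ (r : ℕ) (p : ℕ → MvPolynomial σ K), p r ≠ 0 ∧
      ∑ k ∈ Finset.range (r + 1), p k • (MvPowerSeries.pderiv K i)^[k] F = 0) :
    IsDFinite F := by
  classical
  choose r p hp h using h
  unfold IsDFinite
  set k := IntermediateField.adjoin K (Set.range fun i : σ =>
    algebraMap (MvPowerSeries σ K) (FractionRing (MvPowerSeries σ K)) (MvPowerSeries.X i)) with hk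
  set α := algebraMap (MvPowerSeries σ K) (FractionRing (MvPowerSeries σ K)) with hα
  have hαinj : Function.Injective α := IsFractionRing.injective _ _
  let V : ℕ → Submodule k (FractionRing (MvPowerSeries σ K)) := fun n =>
    Submodule.span k ((fun l => α (iterPderiv F l)) '' {l | l.length < n})
  have hpoly : ∀ q : MvPolynomial σ K, α (q : MvPowerSeries σ K) ∈ k := by
    intro q
    induction q using MvPolynomial.induction_on with
    | C a =>
      rw [MvPolynomial.coe_C]
      exact IntermediateField.algebraMap_mem k a
    | add q q' h h' => rw [MvPolynomial.coe_add, map_add]; exact add_mem h h'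
    | mul_X q i h =>
      rw [MvPolynomial.coe_mul, map_mul, MvPolynomial.coe_X]
      exact mul_mem h (IntermediateField.subset_adjoin K _ ⟨i, rfl⟩)
  have hV : ∀ n, ∀ H ∈ derivSpan F n, α H ∈ V n := by
    intro n H hH
    induction hH using Submodule.span_induction with
    | mem H h =>
      obtain ⟨l, hl, rfl⟩ := h
      exact Submodule.subset_span ⟨l, hl, rfl⟩
    | zero => simp
    | add H H' _ _ h h' => rw [map_add]; exact add_mem h h'
    | smul q H h' h =>
      rw [polynomial_smul_def, map_mul]
      exact Submodule.smul_mem (V n) (⟨_, hpoly q⟩ : k) h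
  have key : ∀ n, ∀ l : List σ, l.length = n → α (iterPderiv F l) ∈ V (∑ i, r i + 1) := by
    intro n
    induction n using Nat.strong_induction_on with
    | _ n ih =>
      intro l hl
      by_cases hn : n < ∑ i, r i + 1
      · exact Submodule.subset_span ⟨l, by simpa [hl] using hn, rfl⟩
      -- Pigeonhole: a word with more than `∑ r i` letters contains some `i` at least `r i` times.
      -- Those letters are moved to the innermost positions, where the equation in `i` applies. Its
      -- leading coefficient is invertible in `k`, so the derivative lies in the span of those of
      -- lower order, covered by induction.
      · obtain ⟨i, hi⟩ : ∃ i, r i ≤ l.count i := by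
          by_contra! hc
          have h1 : ∑ i, l.count i = l.length := by
            have := Multiset.sum_count_eq_card (s := Finset.univ) (m := (l : Multiset σ))
              (fun a _ => Finset.mem_univ a)
            simpa using this
          have h2 := Finset.sum_le_sum fun i (_ : i ∈ Finset.univ) => (hc i).le
          omega
        obtain ⟨l', hl'⟩ : ∃ l', l.Perm (l' ++ List.replicate (r i) i) := by
          have hs : Multiset.replicate (r i) i ≤ (l : Multiset σ) :=
            Multiset.le_count_iff_replicate_le.1 (by simpa using hi)
          obtain ⟨t, ht⟩ := Multiset.le_iff_exists_add.1 hs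
          refine ⟨t.toList, Multiset.coe_eq_coe.1 ?_⟩
          rw [ht, ← Multiset.coe_add, Multiset.coe_toList, Multiset.coe_replicate, add_comm]
        have h1 := hV _ _ (smul_iterPderiv_mem F i (r i) (p i) (h i) l')
        rw [polynomial_smul_def, map_mul, ← iterPderiv_perm F hl', ← hl'.length_eq, hl] at h1
        have hne : (⟨_, hpoly (p i (r i))⟩ : k) ≠ 0 := by
          intro h0
          have h2 : α ((p i (r i) : MvPolynomial σ K) : MvPowerSeries σ K) = 0 :=
            congrArg Subtype.val h0
          rw [map_eq_zero_iff α hαinj] at h2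
          exact hp i (by simpa using h2)
        have h2 : α (iterPderiv F l) ∈ V n := by
          have := Submodule.smul_mem (V n) (⟨_, hpoly (p i (r i))⟩ : k)⁻¹ h1
          have h3 : α ((p i (r i) : MvPolynomial σ K) : MvPowerSeries σ K) * α (iterPderiv F l) =
            (⟨_, hpoly (p i (r i))⟩ : k) • α (iterPderiv F l) := rfl
          rwa [h3, smul_smul, inv_mul_cancel₀ hne, one_smul] at this
        refine (Submodule.span_le.2 ?_) h2
        rintro _ ⟨m, hm, rfl⟩
        exact ih _ hm m rfl
  have hfin : (V (∑ i, r i + 1)).FG :=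
    Submodule.fg_span ((List.finite_length_lt σ _).image _)
  have : FiniteDimensional k (V (∑ i, r i + 1)) := Module.Finite.iff_fg.2 hfin
  refine Submodule.finiteDimensional_of_le (S₂ := V (∑ i, r i + 1)) (Submodule.span_le.2 ?_)
  rintro _ ⟨l, rfl⟩
  exact key _ l rfl

end DFinite

/-! ### Degrees of numerators of derivatives of a rational function -/

section Counting

open MvPolynomial

theorem totalDegree_pderiv_le {σ R : Type*} [CommSemiring R] (i : σ) (p : MvPolynomial σ R) :
    (pderiv i p).totalDegree ≤ p.totalDegree := by
  classical
  conv_lhs => rw [← support_sum_monomial_coeff p]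
  rw [map_sum]
  refine (totalDegree_finsetSum _ _).trans (Finset.sup_le fun s hs => ?_)
  rw [pderiv_monomial]
  refine (totalDegree_monomial_le _ _).trans (le_trans ?_ (le_totalDegree hs))
  have h : s - Finsupp.single i 1 ≤ s := tsub_le_self
  exact Finsupp.degree_mono h

/-- More than `(M + 1) ^ n` polynomials of degree at most `M` in `n` variables are linearly
dependent. -/
theorem exists_relation_of_totalDegree_le {ι σ : Type*} [Fintype ι] [Fintype σ] [DecidableEq σ]
    {M : ℕ} (p : ι → MvPolynomial σ ℚ) (hp : ∀ i, (p i).totalDegree ≤ M)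
    (hcard : (M + 1) ^ Fintype.card σ < Fintype.card ι) :
    ∃ c : ι → ℚ, ∑ i, c i • p i = 0 ∧ ∃ i, c i ≠ 0 := by
  -- A total degree at most `M` puts all exponents in the box `[0, M]^σ`. The box is larger than
  -- needed but has the right order of growth.
  let v : ι → ((σ → Fin (M + 1)) → ℚ) := fun i b =>
    coeff (Finsupp.equivFunOnFinite.symm fun k => (b k : ℕ)) (p i)
  have hv : ¬ LinearIndependent ℚ v := by
    intro h
    have := h.fintype_card_le_finrank
    simp at this
    omega
  obtain ⟨c, hc, hi⟩ := Fintype.not_linearIndependent_iff.1 hv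
  refine ⟨c, ?_, hi⟩
  ext s
  by_cases hs : ∀ k, s k < M + 1
  · have := congrFun hc fun k => ⟨s k, hs k⟩
    have h2 : (Finsupp.equivFunOnFinite.symm fun k => s k) = s := by ext; rfl
    simpa [v, coeff_sum, h2] using this
  · push Not at hs
    obtain ⟨k, hk⟩ := hs
    rw [coeff_sum, coeff_zero]
    refine Finset.sum_eq_zero fun i _ => ?_
    rw [coeff_smul, coeff_eq_zero_of_totalDegree_lt, smul_zero]
    refine lt_of_lt_of_le (lt_of_le_of_lt (hp i) hk) ?_
    rw [← Finsupp.degree_apply]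
    exact Finsupp.le_degree k s

variable {σ : Type*} {A : Type*} [CommRing A] [Algebra ℚ A]

/-- `F` has a polynomial of degree at most `M` as numerator over `D ^ s`. -/
def HasNumerator (v : σ → A) (D : MvPolynomial σ ℚ) (s M : ℕ) (F : A) : Prop :=
  ∃ q : MvPolynomial σ ℚ, q.totalDegree ≤ M ∧ aeval v D ^ s * F = aeval v q

variable {v : σ → A} {D : MvPolynomial σ ℚ} {s M : ℕ} {F : A}

theorem HasNumerator.mono {M' : ℕ} (h : HasNumerator v D s M F) (hM : M ≤ M') :
    HasNumerator v D s M' F := by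
  obtain ⟨q, hq, h⟩ := h
  exact ⟨q, hq.trans hM, h⟩

theorem HasNumerator.X_mul (h : HasNumerator v D s M F) (i : σ) :
    HasNumerator v D s (M + 1) (v i * F) := by
  obtain ⟨q, hq, h⟩ := h
  refine ⟨X i * q, (totalDegree_mul _ _).trans ?_, ?_⟩
  · rw [totalDegree_X]; omega
  · rw [map_mul, aeval_X, ← h]; ring

theorem HasNumerator.X_pow_mul (h : HasNumerator v D s M F) (i : σ) (k : ℕ) :
    HasNumerator v D s (M + k) (v i ^ k * F) := by
  induction k with
  | zero => simpa using h
  | succ k ih =>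
    rw [pow_succ', mul_assoc]
    exact ih.X_mul i

theorem HasNumerator.add_pow (h : HasNumerator v D s M F) (k : ℕ) :
    HasNumerator v D (s + k) (M + k * D.totalDegree) F := by
  obtain ⟨q, hq, h⟩ := h
  refine ⟨D ^ k * q, (totalDegree_mul _ _).trans ?_, ?_⟩
  · have := totalDegree_pow D k
    omega
  · rw [map_mul, map_pow, ← h]; ring

theorem derivation_aeval [DecidableEq σ] (d : σ → Derivation ℚ A A)
    (hd : ∀ i j, d i (v j) = if i = j then 1 else 0) (i : σ)
    (p : MvPolynomial σ ℚ) : d i (aeval v p) = aeval v (pderiv i p) := by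
  induction p using MvPolynomial.induction_on with
  | C a => simp
  | add p q hp hq => simp [hp, hq]
  | mul_X p j hp =>
    rw [map_mul, aeval_X, Derivation.leibniz, hp, hd, Derivation.leibniz, pderiv_X]
    rcases eq_or_ne i j with rfl | h
    · simp
    · simp [h, h.symm]

/-- Quotient rule: differentiate `D^s F = q` and multiply by `D`. The degree bound grows by `deg D`
only, hence linearly in the number of derivatives; the dimension count depends on this linear
growth. -/
theorem HasNumerator.derivation [DecidableEq σ] (d : σ → Derivation ℚ A A)
    (hd : ∀ i j, d i (v j) = if i = j then 1 else 0) (h : HasNumerator v D s M F) (i : σ) :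
    HasNumerator v D (s + 1) (M + D.totalDegree) (d i F) := by
  obtain ⟨q, hq, h⟩ := h
  refine ⟨D * pderiv i q - (s : MvPolynomial σ ℚ) * pderiv i D * q,
    (totalDegree_sub _ _).trans (max_le ?_ ?_), ?_⟩
  · have h1 := totalDegree_mul D (pderiv i q)
    have h2 := totalDegree_pderiv_le i q
    omega
  · have h1 := totalDegree_mul ((s : MvPolynomial σ ℚ) * pderiv i D) q
    have h2 := totalDegree_mul (s : MvPolynomial σ ℚ) (pderiv i D)
    have h3 := totalDegree_pderiv_le i D
    have h4 : (s : MvPolynomial σ ℚ).totalDegree = 0 := by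
      rw [← map_natCast (C : ℚ →+* MvPolynomial σ ℚ), totalDegree_C]
    omega
  · have h1 := congrArg (d i) h
    rw [derivation_aeval d hd, Derivation.leibniz, Derivation.leibniz_pow,
      derivation_aeval d hd] at h1
    simp only [smul_eq_mul, nsmul_eq_mul] at h1
    rw [map_sub, map_mul, map_mul, map_mul, map_natCast, ← h1, ← h]
    -- The exponent `s - 1` from the power rule is truncated at `s = 0`, where its term carries the
    -- factor `0`.
    rcases s with _ | s
    · simp
    · rw [Nat.add_sub_cancel]; push_cast; ring

theorem HasNumerator.derivation_iterate [DecidableEq σ] (d : σ → Derivation ℚ A A)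
    (hd : ∀ i j, d i (v j) = if i = j then 1 else 0) (h : HasNumerator v D s M F) (i : σ)
    (k : ℕ) : HasNumerator v D (s + k) (M + k * D.totalDegree) ((d i)^[k] F) := by
  induction k with
  | zero => simpa using h
  | succ k ih =>
    rw [Function.iterate_succ_apply', add_mul, one_mul]
    exact (ih.derivation d hd i).mono (add_assoc _ _ _).le

end Counting

/-! ### Annihilating operators by dimension count -/

section Holonomic

open MvPolynomial

/-- A derivation from an additive map that satisfies the Leibniz rule. -/
def derivationOfAddMonoidHom {A : Type*} [CommRing A] [Algebra ℚ A] (f : A →+ A)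
    (h : ∀ a b, f (a * b) = a * f b + b * f a) : Derivation ℚ A A :=
  Derivation.mk' f.toRatLinearMap h

/-- A rational function `G` of five variables is annihilated by a nonzero differential operator
in three derivations whose coefficients are polynomials in three of the variables. -/
theorem exists_operator {σ : Type*} [Fintype σ] [DecidableEq σ] (hσ : Fintype.card σ = 5)
    {A : Type*} [CommRing A] [NoZeroDivisors A] [Nontrivial A] [Algebra ℚ A]
    (v : σ → A) (d : σ → A →+ A) (hd : ∀ i j, d i (v j) = if i = j then 1 else 0)
    (hmul : ∀ i a b, d i (a * b) = a * d i b + b * d i a) (D p : MvPolynomial (σ) ℚ)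
    (hD : aeval v D ≠ 0) (G : A) (hG : aeval v D * G = aeval v p) (w : Fin 3 → σ)
    (e e' e'' : σ) :
    ∃ (N : ℕ) (P : Fin N × Fin N × Fin N → MvPolynomial (Fin 3) ℚ), (∃ k, P k ≠ 0) ∧
      ∑ k, aeval (v ∘ w) (P k) * (d e)^[k.1] ((d e')^[k.2.1] ((d e'')^[k.2.2] G)) = 0 := by
  let d' i : Derivation ℚ A A := derivationOfAddMonoidHom (d i) (hmul i)
  obtain ⟨δ, hδ⟩ : ∃ δ, δ = D.totalDegree := ⟨_, rfl⟩
  -- `M` bounds the numerators, over the common denominator `D^(1+3N)`, of all operator monomials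
  -- with exponents below `N`. Since `M + 1 ≤ N C₀`, there are at most `N^5 C₀^5` exponents, fewer
  -- than the `N^6` operator monomials as soon as `N > C₀^5`.
  obtain ⟨C₀, hC₀⟩ : ∃ C₀, C₀ = p.totalDegree + 1 + 3 * (δ + 1) := ⟨_, rfl⟩
  obtain ⟨N, hN⟩ : ∃ N, N = C₀ ^ 5 + 1 := ⟨_, rfl⟩
  obtain ⟨M, hM⟩ : ∃ M, M = p.totalDegree + 3 * N * δ + 3 * N := ⟨_, rfl⟩
  let op : (Fin 3 → Fin N) × (Fin N × Fin N × Fin N) → A := fun α =>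
    v (w 0) ^ (α.1 0 : ℕ) * (v (w 1) ^ (α.1 1 : ℕ) * (v (w 2) ^ (α.1 2 : ℕ) *
      (d e)^[α.2.1] ((d e')^[α.2.2.1] ((d e'')^[α.2.2.2] G))))
  have hop : ∀ α, HasNumerator v D (1 + 3 * N) M (op α) := by
    rintro ⟨a, k⟩
    have h0 : HasNumerator v D 1 p.totalDegree G := ⟨p, le_rfl, by simpa using hG⟩
    have h1 := (((h0.derivation_iterate d' hd e'' k.2.2).derivation_iterate d' hd e'
      k.2.1).derivation_iterate d' hd e k.1).add_pow (3 * N - (k.1 + k.2.1 + k.2.2 : ℕ))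
    have h2 := ((h1.X_pow_mul (w 2) (a 2)).X_pow_mul (w 1) (a 1)).X_pow_mul (w 0) (a 0)
    have b1 := k.1.2
    have b2 := k.2.1.2
    have b3 := k.2.2.2
    have e1 : 1 + (k.2.2 : ℕ) + k.2.1 + k.1 + (3 * N - (k.1 + k.2.1 + k.2.2 : ℕ)) = 1 + 3 * N := by
      omega
    rw [e1, ← hδ] at h2
    refine h2.mono ?_
    have e2 : p.totalDegree + k.2.2 * δ + k.2.1 * δ + k.1 * δ +
        (3 * N - (k.1 + k.2.1 + k.2.2 : ℕ)) * δ = p.totalDegree + 3 * N * δ := by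
      have : 3 * N = k.2.2 + k.2.1 + k.1 + (3 * N - (k.1 + k.2.1 + k.2.2 : ℕ)) := by omega
      conv_rhs => rw [this]
      ring
    rw [e2]
    have b4 := (a 0).2
    have b5 := (a 1).2
    have b6 := (a 2).2
    omega
  choose q hq hq' using hop
  have hcard : (M + 1) ^ 5 < Fintype.card ((Fin 3 → Fin N) × (Fin N × Fin N × Fin N)) := by
    have h1 : M + 1 ≤ N * C₀ := by
      have : 1 ≤ N := by omega
      calc M + 1 = (p.totalDegree + 1) * 1 + N * (3 * (δ + 1)) := by rw [hM]; ring
        _ ≤ (p.totalDegree + 1) * N + N * (3 * (δ + 1)) := by gcongr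
        _ = N * C₀ := by rw [hC₀]; ring
    calc (M + 1) ^ 5 ≤ (N * C₀) ^ 5 := by gcongr
      _ = N ^ 5 * C₀ ^ 5 := by ring
      _ < N ^ 5 * N := by
        have : 0 < N := by omega
        gcongr
        omega
      _ = _ := by simp; ring
  obtain ⟨c, hc, ⟨a₀, k₀⟩, hne⟩ := exists_relation_of_totalDegree_le q hq (hσ ▸ hcard)
  refine ⟨N, fun k => ∑ a : Fin 3 → Fin N,
    monomial (Finsupp.equivFunOnFinite.symm fun i => (a i : ℕ)) (c (a, k)), ⟨k₀, ?_⟩, ?_⟩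
  · intro h
    have h1 := congrArg (coeff (Finsupp.equivFunOnFinite.symm fun i => (a₀ i : ℕ))) h
    rw [coeff_sum, Finset.sum_eq_single a₀] at h1
    · simp only [coeff_monomial, if_true, coeff_zero] at h1
      exact hne h1
    · intro a _ ha
      rw [coeff_monomial, if_neg]
      intro h2
      apply ha
      funext i
      exact Fin.ext (DFunLike.congr_fun h2 i)
    · simp
  · have h1 : aeval v D ^ (1 + 3 * N) * ∑ α, c α • op α = 0 := by
      rw [Finset.mul_sum]
      simp only [mul_smul_comm, hq']
      simp only [← map_smul, ← map_sum, hc, map_zero]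
    have h2 := (mul_eq_zero.1 h1).resolve_left (pow_ne_zero _ hD)
    rw [Fintype.sum_prod_type, Finset.sum_comm] at h2
    rw [← h2]
    refine Finset.sum_congr rfl fun k _ => ?_
    rw [map_sum, Finset.sum_mul]
    refine Finset.sum_congr rfl fun a _ => ?_
    rw [aeval_monomial, Finsupp.prod_fintype _ _ (by simp), Fin.prod_univ_three,
      Algebra.smul_def]
    simp [op]
    ring

end Holonomic

/-! ### Derivations of power series and Laurent series rings -/

section Derivations

/-- The additive map of a multivariate power series ring that applies `d` to each coefficient. -/
def mvPowerSeriesMap {σ K : Type*} [CommRing K] (d : K →+ K) :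
    MvPowerSeries σ K →+ MvPowerSeries σ K where
  toFun F m := d (MvPowerSeries.coeff m F)
  map_zero' := by ext m; exact map_zero d
  map_add' F G := by ext m; exact map_add d _ _

theorem coeff_mvPowerSeriesMap {σ K : Type*} [CommRing K] (d : K →+ K) (F : MvPowerSeries σ K)
    (m : σ →₀ ℕ) :
    MvPowerSeries.coeff m (mvPowerSeriesMap d F) = d (MvPowerSeries.coeff m F) := rfl

theorem mvPowerSeriesMap_mul {σ K : Type*} [CommRing K] (d : K →+ K)
    (hd : ∀ a b, d (a * b) = a * d b + b * d a) (F G : MvPowerSeries σ K) :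
    mvPowerSeriesMap d (F * G) = F * mvPowerSeriesMap d G + G * mvPowerSeriesMap d F := by
  classical
  ext m
  rw [coeff_mvPowerSeriesMap, map_add, MvPowerSeries.coeff_mul, MvPowerSeries.coeff_mul,
    mul_comm G, MvPowerSeries.coeff_mul, map_sum, ← Finset.sum_add_distrib]
  refine Finset.sum_congr rfl fun p _ => ?_
  rw [hd, mul_comm (MvPowerSeries.coeff p.2 G)]
  rfl

/-- The additive map of a Laurent series ring that applies `d` to each coefficient. -/
def laurentMap {K : Type*} [CommRing K] (d : K →+ K) : LaurentSeries K →+ LaurentSeries K where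
  toFun F := HahnSeries.map F d
  map_zero' := by ext m; simp
  map_add' F G := by ext m; simp

theorem coeff_laurentMap {K : Type*} [CommRing K] (d : K →+ K) (F : LaurentSeries K) (m : ℤ) :
    (laurentMap d F).coeff m = d (F.coeff m) := rfl

theorem laurentMap_mul {K : Type*} [CommRing K] (d : K →+ K)
    (hd : ∀ a b, d (a * b) = a * d b + b * d a) (F G : LaurentSeries K) :
    laurentMap d (F * G) = F * laurentMap d G + G * laurentMap d F := by
  ext m
  -- Supports do not grow, so all three products can be summed over the index set of `F * G`.
  have hs : ∀ H : LaurentSeries K, (laurentMap d H).support ⊆ H.support := fun H k hk h0 => hk (by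
    rw [coeff_laurentMap, h0, map_zero])
  rw [coeff_laurentMap, HahnSeries.coeff_add, HahnSeries.coeff_mul,
    HahnSeries.coeff_mul_right' G.isPWO_support (hs G), mul_comm G,
    HahnSeries.coeff_mul_left' F.isPWO_support (hs F), map_sum, ← Finset.sum_add_distrib]
  refine Finset.sum_congr rfl fun p _ => ?_
  rw [hd, mul_comm (G.coeff p.2)]
  rfl

/-- The Euler operator of Laurent series. -/
def laurentEuler (K : Type*) [CommRing K] (F : LaurentSeries K) : LaurentSeries K where
  coeff m := (m : K) * F.coeff m
  isPWO_support' := F.isPWO_support.mono fun m hm h0 => hm (by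
    change (m : K) * F.coeff m = 0
    rw [h0, mul_zero])

/-- In each summand the degree splits as `m = p.1 + p.2`. The Euler operator does not enlarge
supports; the derivative then differs from it only by a factor `x⁻¹`. -/
theorem laurentEuler_mul {K : Type*} [CommRing K] (F G : LaurentSeries K) :
    laurentEuler K (F * G) = F * laurentEuler K G + G * laurentEuler K F := by
  ext m
  have hs : ∀ H : LaurentSeries K, (laurentEuler K H).support ⊆ H.support := fun H k hk h0 => hk (by
    change (k : K) * H.coeff k = 0
    rw [h0, mul_zero])
  change (m : K) * (F * G).coeff m = _
  rw [HahnSeries.coeff_add, HahnSeries.coeff_mul,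
    HahnSeries.coeff_mul_right' G.isPWO_support (hs G), mul_comm G,
    HahnSeries.coeff_mul_left' F.isPWO_support (hs F), Finset.mul_sum, ← Finset.sum_add_distrib]
  refine Finset.sum_congr rfl fun p hp => ?_
  have h : (m : K) = p.1 + p.2 := by
    rw [← (Finset.mem_antidiagonal.1 hp).2.2]
    push_cast; rfl
  change _ = F.coeff p.1 * ((p.2 : K) * G.coeff p.2) + (p.1 : K) * F.coeff p.1 * G.coeff p.2
  rw [h]; ring

/-- The derivative of Laurent series. -/
def laurentDeriv (K : Type*) [CommRing K] : LaurentSeries K →+ LaurentSeries K where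
  toFun F := HahnSeries.single (-1) 1 * laurentEuler K F
  map_zero' := by rw [show laurentEuler K 0 = 0 by ext; exact mul_zero _, mul_zero]
  map_add' F G := by rw [← mul_add]; congr 1; ext; exact mul_add _ _ _

theorem laurentDeriv_mul {K : Type*} [CommRing K] (F G : LaurentSeries K) :
    laurentDeriv K (F * G) = F * laurentDeriv K G + G * laurentDeriv K F := by
  change HahnSeries.single (-1) 1 * laurentEuler K (F * G) =
    F * (HahnSeries.single (-1) 1 * _) + G * (HahnSeries.single (-1) 1 * _)
  rw [laurentEuler_mul]
  ring

theorem coeff_laurentDeriv {K : Type*} [CommRing K] (F : LaurentSeries K) (m : ℤ) :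
    (laurentDeriv K F).coeff m = ((m + 1 : ℤ) : K) * F.coeff (m + 1) := by
  change (HahnSeries.single (-1) 1 * laurentEuler K F).coeff m = _
  rw [HahnSeries.coeff_single_mul, one_mul, sub_neg_eq_add]
  rfl

theorem mvPowerSeriesMap_C {σ K : Type*} [CommRing K] (d : K →+ K) (a : K) :
    mvPowerSeriesMap d (MvPowerSeries.C a : MvPowerSeries σ K) = MvPowerSeries.C (d a) := by
  classical
  ext m
  rw [coeff_mvPowerSeriesMap, MvPowerSeries.coeff_C, MvPowerSeries.coeff_C]
  split_ifs <;> simp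

theorem mvPowerSeriesMap_X {σ K : Type*} [CommRing K] (d : K →+ K) (hd : d 1 = 0) (i : σ) :
    mvPowerSeriesMap d (MvPowerSeries.X i : MvPowerSeries σ K) = 0 := by
  classical
  ext m
  rw [coeff_mvPowerSeriesMap, MvPowerSeries.coeff_X]
  split_ifs <;> simp [hd]

theorem laurentDeriv_X (K : Type*) [CommRing K] :
    laurentDeriv K (HahnSeries.single 1 1) = 1 := by
  ext m
  rw [coeff_laurentDeriv, HahnSeries.coeff_single, HahnSeries.coeff_one]
  rcases eq_or_ne m 0 with rfl | h
  · simp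
  · simp [h]

theorem laurentDeriv_C {K : Type*} [CommRing K] (a : K) :
    laurentDeriv K (HahnSeries.C a) = 0 := by
  ext m
  rw [coeff_laurentDeriv, HahnSeries.C_apply, HahnSeries.coeff_single]
  rcases eq_or_ne (m + 1) 0 with h | h <;> simp [h]

theorem laurentDeriv_one (K : Type*) [CommRing K] : laurentDeriv K 1 = 0 := laurentDeriv_C 1

theorem laurentMap_single {K : Type*} [CommRing K] (d : K →+ K) (k : ℤ) (a : K) :
    laurentMap d (HahnSeries.single k a) = HahnSeries.single k (d a) := by
  ext m
  rw [coeff_laurentMap, HahnSeries.coeff_single, HahnSeries.coeff_single]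
  split_ifs <;> simp

end Derivations

/-! ### Coefficient extraction in `ℚ((x))((y))[[u, v, t]]` -/

section Residue

/-- The field `ℚ((x))((y))`. -/
abbrev LXY : Type := LaurentSeries (LaurentSeries ℚ)

/-- The ring `ℚ((x))((y))[[u, v, t]]`. -/
abbrev LXYuvt : Type := MvPowerSeries (Fin 3) LXY

/-- The derivations of `ℚ((x))((y))` with respect to `x` and `y`. -/
def kder : Fin 2 → LXY →+ LXY := ![laurentMap (laurentDeriv ℚ), laurentDeriv _]

/-- The variables `x` and `y` of `ℚ((x))((y))`. -/
def kvar : Fin 2 → LXY := ![HahnSeries.C (HahnSeries.single 1 1), HahnSeries.single 1 1]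

theorem kder_zero : kder 0 = laurentMap (laurentDeriv ℚ) := rfl
theorem kder_one : kder 1 = laurentDeriv (LaurentSeries ℚ) := rfl
theorem kvar_zero : kvar 0 = HahnSeries.C (HahnSeries.single 1 1) := rfl
theorem kvar_one : kvar 1 = HahnSeries.single 1 1 := rfl

theorem kder_mul (i : Fin 2) (F G : LXY) : kder i (F * G) = F * kder i G + G * kder i F := by
  revert i
  rw [Fin.forall_fin_two, kder_zero, kder_one]
  exact ⟨laurentMap_mul _ laurentDeriv_mul F G, laurentDeriv_mul F G⟩

theorem kder_apply_one (i : Fin 2) : kder i 1 = 0 := by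
  have h := kder_mul i 1 1
  simpa using h

theorem kder_kvar (i j : Fin 2) : kder i (kvar j) = if i = j then 1 else 0 := by
  revert i j
  simp only [Fin.forall_fin_two, kder_zero, kder_one, kvar_zero, kvar_one]
  refine ⟨⟨?_, ?_⟩, ?_, ?_⟩
  · rw [HahnSeries.C_apply, laurentMap_single, laurentDeriv_X]
    rfl
  · rw [laurentMap_single, laurentDeriv_one, map_zero]
    rfl
  · rw [laurentDeriv_C]
    rfl
  · rw [laurentDeriv_X]
    rfl

/-- The variables `x, y` and `u, v, t`. -/
def lvar : Fin 2 ⊕ Fin 3 → LXYuvt :=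
  Sum.elim (fun i => MvPowerSeries.C (kvar i)) MvPowerSeries.X

/-- The derivations with respect to `x, y` and `u, v, t`. -/
def lder : Fin 2 ⊕ Fin 3 → LXYuvt →+ LXYuvt :=
  Sum.elim (fun i => mvPowerSeriesMap (kder i))
    (fun i => (MvPowerSeries.pderiv LXY i : LXYuvt →ₗ[LXY] LXYuvt).toAddMonoidHom)

theorem lder_inl (i : Fin 2) : lder (Sum.inl i) = mvPowerSeriesMap (kder i) := rfl

theorem lder_inr (i : Fin 3) (F : LXYuvt) :
    lder (Sum.inr i) F = MvPowerSeries.pderiv LXY i F := rfl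

theorem lder_mul (i : Fin 2 ⊕ Fin 3) (F G : LXYuvt) :
    lder i (F * G) = F * lder i G + G * lder i F := by
  rcases i with i | i
  · exact mvPowerSeriesMap_mul _ (kder_mul i) F G
  · exact Derivation.leibniz (MvPowerSeries.pderiv LXY i) F G

theorem lder_lvar (i j : Fin 2 ⊕ Fin 3) : lder i (lvar j) = if i = j then 1 else 0 := by
  rcases i with i | i <;> rcases j with j | j
  · change mvPowerSeriesMap (kder i) (MvPowerSeries.C (kvar j)) = _
    rw [mvPowerSeriesMap_C, kder_kvar]
    simp only [Sum.inl.injEq]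
    split_ifs <;> simp
  · exact mvPowerSeriesMap_X _ (kder_apply_one i) j
  · exact MvPowerSeries.pderiv_C
  · change MvPowerSeries.pderiv LXY i (MvPowerSeries.X j) = _
    simp only [Sum.inr.injEq]
    rw [MvPowerSeries.pderiv_X, Pi.single_apply]
    simp only [eq_comm]

/-- The coefficient of `x ^ a * y ^ b` as a power series in `u, v, t`. -/
def lcoeff (a b : ℤ) : LXYuvt →+ MvPowerSeries (Fin 3) ℚ where
  toFun F := fun m => ((MvPowerSeries.coeff m F).coeff b).coeff a
  map_zero' := by ext; simp; rfl
  map_add' F G := by ext; rfl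

theorem coeff_lcoeff (a b : ℤ) (F : LXYuvt) (m : Fin 3 →₀ ℕ) :
    MvPowerSeries.coeff m (lcoeff a b F) = ((MvPowerSeries.coeff m F).coeff b).coeff a := rfl

/-- Polynomials in `u, v, t` are constants for the extraction in `x` and `y`. This is why the
annihilating operator must have coefficients free of `x` and `y`. -/
theorem lcoeff_aeval_mul (a b : ℤ) (p : MvPolynomial (Fin 3) ℚ) (F : LXYuvt) :
    lcoeff a b (MvPolynomial.aeval (lvar ∘ Sum.inr) p * F) = p • lcoeff a b F := by
  classical
  rw [polynomial_smul_def]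
  induction p using MvPolynomial.induction_on generalizing F with
  | C r =>
    rw [MvPolynomial.aeval_C, MvPolynomial.coe_C]
    have h : algebraMap ℚ LXYuvt =
        (MvPowerSeries.C).comp ((HahnSeries.C (Γ := ℤ)).comp (HahnSeries.C (Γ := ℤ))) :=
      Subsingleton.elim _ _
    ext m
    rw [h, coeff_lcoeff, RingHom.comp_apply, MvPowerSeries.coeff_C_mul, MvPowerSeries.coeff_C_mul,
      RingHom.comp_apply, HahnSeries.C_apply, HahnSeries.coeff_single_zero_mul, HahnSeries.C_apply,
      HahnSeries.coeff_single_zero_mul, coeff_lcoeff]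
  | add p q hp hq => rw [map_add, add_mul, map_add, hp, hq, MvPolynomial.coe_add, add_mul]
  | mul_X p i hp =>
    rw [map_mul (MvPolynomial.aeval _), mul_assoc, hp, MvPolynomial.coe_mul,
      mul_assoc, MvPolynomial.aeval_X,
      MvPolynomial.coe_X]
    congr 1
    ext m
    change ((MvPowerSeries.coeff m (MvPowerSeries.X i * F)).coeff b).coeff a = _
    rw [MvPowerSeries.X, MvPowerSeries.X, MvPowerSeries.coeff_monomial_mul,
      MvPowerSeries.coeff_monomial_mul, one_mul, one_mul]
    split_ifs
    · rfl
    · simp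

theorem lcoeff_pderiv (a b : ℤ) (e : Fin 3) (F : LXYuvt) (k : ℕ) :
    lcoeff a b ((lder (Sum.inr e))^[k] F) = (MvPowerSeries.pderiv ℚ e)^[k] (lcoeff a b F) := by
  induction k with
  | zero => rfl
  | succ k ih =>
    rw [Function.iterate_succ_apply', Function.iterate_succ_apply', ← ih]
    generalize (lder (Sum.inr e))^[k] F = G
    ext m
    rw [coeff_lcoeff, lder_inr, MvPowerSeries.coeff_pderiv, MvPowerSeries.coeff_pderiv,
      coeff_lcoeff]
    have h : ((m e : LXY) + 1) = HahnSeries.C (HahnSeries.C ((m e : ℚ) + 1)) := by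
      rw [map_add, map_add, map_natCast, map_natCast, map_one, map_one]
    rw [h, HahnSeries.C_apply, HahnSeries.coeff_mul_single_zero, HahnSeries.C_apply,
      HahnSeries.coeff_mul_single_zero]

theorem lcoeff_lder_zero (a b : ℤ) (F : LXYuvt) :
    lcoeff a b (lder (Sum.inl 0) F) = ((a + 1 : ℤ) : ℚ) • lcoeff (a + 1) b F := by
  ext m
  rw [coeff_lcoeff, lder_inl, coeff_mvPowerSeriesMap, kder_zero, coeff_laurentMap,
    coeff_laurentDeriv]
  rfl

theorem lcoeff_lder_one (a b : ℤ) (F : LXYuvt) :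
    lcoeff a b (lder (Sum.inl 1) F) = ((b + 1 : ℤ) : ℚ) • lcoeff a (b + 1) F := by
  ext m
  rw [coeff_lcoeff, lder_inl, coeff_mvPowerSeriesMap, kder_one, coeff_laurentDeriv]
  have h : ((b + 1 : ℤ) : LaurentSeries ℚ) = HahnSeries.C ((b + 1 : ℤ) : ℚ) :=
    (map_intCast _ _).symm
  rw [h, HahnSeries.C_apply, HahnSeries.coeff_single_zero_mul]
  rfl

/-- Integration by parts: derivatives in `x` and `y` act on coefficients by scalars. -/
theorem lcoeff_lder (a b : ℤ) (F : LXYuvt) (k l : ℕ) :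
    lcoeff a b ((lder (Sum.inl 0))^[k] ((lder (Sum.inl 1))^[l] F)) =
      ((∏ i ∈ Finset.range k, ((a + i + 1 : ℤ) : ℚ)) *
        ∏ i ∈ Finset.range l, ((b + i + 1 : ℤ) : ℚ)) • lcoeff (a + k) (b + l) F := by
  induction k generalizing a with
  | zero =>
    induction l generalizing b with
    | zero => simp
    | succ l ih =>
      rw [Function.iterate_zero, id, Function.iterate_succ_apply', lcoeff_lder_one]
      have := ih (b + 1)
      rw [Function.iterate_zero, id] at this
      rw [this, smul_smul, Finset.prod_range_succ' _ l,
        show b + 1 + (l : ℤ) = b + (l + 1 : ℕ) by push_cast; ring]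
      congr 1
      · simp only [Finset.range_zero, Finset.prod_empty, one_mul]
        rw [mul_comm]
        congr 1
        · refine Finset.prod_congr rfl fun i _ => ?_
          push_cast; ring
        · push_cast; ring
  | succ k ih =>
    rw [Function.iterate_succ_apply', lcoeff_lder_zero, ih, smul_smul, Finset.prod_range_succ' _ k,
      show a + 1 + (k : ℤ) = a + (k + 1 : ℕ) by push_cast; ring]
    congr 1
    · rw [mul_comm, mul_right_comm]
      congr 2
      · refine Finset.prod_congr rfl fun i _ => ?_
        push_cast; ring
      · push_cast; ring

end Residue

/-! ### D-finiteness of residues -/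

section Residue

theorem exists_leading_term {σ K : Type*} [Field K] (F : MvPowerSeries σ K) (i : σ) (N : ℕ)
    (p : ℕ → MvPolynomial σ K) (hp : ∃ k < N, p k ≠ 0)
    (h : ∑ k ∈ Finset.range N, p k • (MvPowerSeries.pderiv K i)^[k] F = 0) :
    ∃ r : ℕ, p r ≠ 0 ∧
      ∑ k ∈ Finset.range (r + 1), p k • (MvPowerSeries.pderiv K i)^[k] F = 0 := by
  classical
  obtain ⟨k, hk, hne⟩ := hp
  set r := Nat.findGreatest (fun k => p k ≠ 0) (N - 1) with hr
  have h1 : p r ≠ 0 := Nat.findGreatest_spec (P := fun k => p k ≠ 0) (by omega : k ≤ N - 1) hne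
  have h2 : r ≤ N - 1 := Nat.findGreatest_le _
  refine ⟨r, h1, ?_⟩
  rw [← h]
  refine Finset.sum_subset (fun j hj => ?_) fun j hj hj' => ?_
  · simp only [Finset.mem_range] at hj ⊢
    omega
  · simp only [Finset.mem_range] at hj hj'
    have h3 : ¬ p j ≠ 0 := Nat.findGreatest_is_greatest (P := fun k => p k ≠ 0)
      (by omega : r < j) (by omega)
    rw [not_not.1 h3, zero_smul]

theorem pderiv_iterate_smul {σ K : Type*} [Field K] (i : σ) (k : ℕ) (c : K)
    (F : MvPowerSeries σ K) :
    (MvPowerSeries.pderiv K i)^[k] (c • F) = c • (MvPowerSeries.pderiv K i)^[k] F := by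
  induction k with
  | zero => rfl
  | succ k ih =>
    rw [Function.iterate_succ_apply', ih, Derivation.map_smul, Function.iterate_succ_apply']

/-- The residue in `x` and `y` of a rational function of `x, y, u, v, t` is D-finite. -/
theorem isDFinite_lcoeff (D p : MvPolynomial (Fin 2 ⊕ Fin 3) ℚ)
    (hD : MvPolynomial.aeval lvar D ≠ 0) (G : LXYuvt)
    (hG : MvPolynomial.aeval lvar D * G = MvPolynomial.aeval lvar p) :
    IsDFinite (lcoeff (-1) (-1) G) := by
  classical
  suffices h : ∀ e : Fin 3, ∃ (N : ℕ) (P : ℕ → MvPolynomial (Fin 3) ℚ), (∃ k < N, P k ≠ 0) ∧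
      ∑ k ∈ Finset.range N, P k • (MvPowerSeries.pderiv ℚ e)^[k] (lcoeff (-1) (-1) G) = 0 by
    refine isDFinite_of_ode _ fun e => ?_
    obtain ⟨N, P, h1, h2⟩ := h e
    obtain ⟨r, h3⟩ := exists_leading_term _ _ N P h1 h2
    exact ⟨r, P, h3⟩
  intro e
  obtain ⟨N, P, hP, hsum⟩ := exists_operator (by simp) lvar lder lder_lvar lder_mul D p hD G hG
    Sum.inr (Sum.inr e) (Sum.inl 0) (Sum.inl 1)
  -- A term of least total order `a + b` in `∂x, ∂y`. Every other exponent pair `(a', b')` that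
  -- occurs then has `a' > a` or `b' > b`.
  obtain ⟨⟨k₀, a, b⟩, hk₀, hmin⟩ := Finset.exists_min_image
    (Finset.univ.filter fun k => P k ≠ 0) (fun k => (k.2.1 : ℕ) + k.2.2)
    (by obtain ⟨k, hk⟩ := hP; exact ⟨k, by simpa using hk⟩)
  simp only [Finset.mem_filter, Finset.mem_univ, true_and] at hk₀ hmin
  -- In the coefficient of `x^(-1-a) y^(-1-b)`, the term of `∂x^a' ∂y^b'` acquires a factor that
  -- vanishes if `a' > a` or `b' > b`, since differentiation leaves no term in `x⁻¹` or `y⁻¹`. Only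
  -- `(a, b)` survives: it yields a nonzero multiple of the residue at `(-1, -1)`.
  have key := congrArg (lcoeff (-1 - a) (-1 - b)) hsum
  rw [map_sum, map_zero] at key
  simp only [lcoeff_aeval_mul, lcoeff_pderiv, lcoeff_lder, pderiv_iterate_smul] at key
  have hprod : ∀ (a : ℕ) (k : ℕ), a < k →
      ∏ i ∈ Finset.range k, ((-1 - a + i + 1 : ℤ) : ℚ) = 0 := fun a k h =>
    Finset.prod_eq_zero (Finset.mem_range.2 h) (by push_cast; ring)
  have hprod' : ∀ a : ℕ, ∏ i ∈ Finset.range a, ((-1 - a + i + 1 : ℤ) : ℚ) ≠ 0 := fun a => by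
    refine Finset.prod_ne_zero_iff.2 fun i hi => ?_
    have := Finset.mem_range.1 hi
    rw [Int.cast_ne_zero]
    omega
  refine ⟨N, fun k => if h : k < N then P (⟨k, h⟩, a, b) else 0, ⟨k₀, k₀.2, by simpa using hk₀⟩, ?_⟩
  rw [Finset.sum_range]
  simp only [Fin.is_lt, dite_true, Fin.eta]
  have hc := mul_ne_zero (hprod' a) (hprod' b)
  set c := (∏ i ∈ Finset.range (a : ℕ), ((-1 - (a : ℕ) + i + 1 : ℤ) : ℚ)) *
    ∏ i ∈ Finset.range (b : ℕ), ((-1 - (b : ℕ) + i + 1 : ℤ) : ℚ) with hcdef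
  have h1 : ∑ k : Fin N, P (k, a, b) • c •
      (MvPowerSeries.pderiv ℚ e)^[k] (lcoeff (-1) (-1) G) = 0 := by
    rw [← key, Fintype.sum_prod_type]
    refine Finset.sum_congr rfl fun k _ => ?_
    rw [Finset.sum_eq_single (a, b)]
    · rw [sub_add_cancel, sub_add_cancel]
    · rintro ⟨a', b'⟩ _ hne
      by_cases h0 : P (k, a', b') = 0
      · rw [h0, zero_smul]
      · have h2 := hmin _ h0
        have h3 : (a : ℕ) < a' ∨ (b : ℕ) < b' := by
          by_contra! hlt
          apply hne
          simp only at h2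
          exact Prod.ext (Fin.ext (by simp only; omega)) (Fin.ext (by simp only; omega))
        rcases h3 with h3 | h3
        · rw [hprod _ _ h3, zero_mul, zero_smul, smul_zero]
        · rw [hprod _ _ h3, mul_zero, zero_smul, smul_zero]
    · simp
  have h2 : c • ∑ k : Fin N, P (k, a, b) •
      (MvPowerSeries.pderiv ℚ e)^[k] (lcoeff (-1) (-1) G) = 0 := by
    rw [← h1, Finset.smul_sum]
    refine Finset.sum_congr rfl fun k _ => ?_
    rw [polynomial_smul_def, polynomial_smul_def, mul_smul_comm]
  exact (smul_eq_zero_iff_right hc).1 h2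

end Residue

/-! ### Iterated Laurent expansions of rational functions and their coefficients -/

section RationalFunctions

open scoped RatFunc in
/-- The expansion of rational functions of one variable as Laurent series. -/
def ratFuncToLaurent (F : Type*) [Field F] : RatFunc F →+* LaurentSeries F :=
  algebraMap (RatFunc F) (LaurentSeries F)

open scoped RatFunc in
theorem ratFuncToLaurent_apply {F : Type*} [Field F] (f : RatFunc F) :
    ratFuncToLaurent F f = (f : LaurentSeries F) := rfl

theorem ratFuncToLaurent_X (F : Type*) [Field F] :
    ratFuncToLaurent F RatFunc.X = HahnSeries.single 1 1 := RatFunc.coe_X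

theorem ratFuncToLaurent_C {F : Type*} [Field F] (a : F) :
    ratFuncToLaurent F (RatFunc.C a) = HahnSeries.C a := by
  rw [ratFuncToLaurent_apply, ← RatFunc.algebraMap_C, ← RatFunc.coePolynomial_eq_algebraMap,
    ← RatFunc.coe_coe]
  simp

/-- The map of Laurent series rings induced by a ring homomorphism. -/
def laurentMapHom {R S : Type*} [CommRing R] [CommRing S] (f : R →+* S) :
    LaurentSeries R →+* LaurentSeries S where
  toFun F := HahnSeries.map F f
  map_one' := HahnSeries.map_one f.toMonoidWithZeroHom
  map_mul' F G := HahnSeries.map_mul (f : R →ₙ+* S)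
  map_zero' := by ext; simp
  map_add' F G := by ext; simp

theorem laurentMapHom_single {R S : Type*} [CommRing R] [CommRing S] (f : R →+* S) (k : ℤ)
    (a : R) : laurentMapHom f (HahnSeries.single k a) = HahnSeries.single k (f a) :=
  HahnSeries.map_single f.toMonoidWithZeroHom.toZeroHom

theorem ratFunc_induction_subfield {F : Type*} [Field F] (U : Subfield (RatFunc F))
    (hC : ∀ a, RatFunc.C a ∈ U) (hX : RatFunc.X ∈ U) : U = ⊤ := by
  have h : ∀ p : Polynomial F, algebraMap _ (RatFunc F) p ∈ U := fun p => by
    induction p using Polynomial.induction_on' with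
    | add p q hp hq => rw [map_add]; exact add_mem hp hq
    | monomial n a =>
      rw [RatFunc.algebraMap_monomial]
      exact mul_mem (hC a) (pow_mem hX n)
  refine top_le_iff.1 fun f _ => ?_
  rw [← RatFunc.num_div_denom f]
  exact div_mem (h _) (h _)

theorem subfield_closure_xy : Subfield.closure {x, y} = (⊤ : Subfield Qxy) := by
  refine ratFunc_induction_subfield _ (fun a => ?_) (Subfield.subset_closure (by simp [y]))
  have h : (Subfield.closure {x, y}).comap (RatFunc.C : Qx →+* Qxy) = ⊤ := by
    refine ratFunc_induction_subfield _ (fun r => ?_) (Subfield.subset_closure (by simp [x]))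
    rw [Subfield.mem_comap, show RatFunc.C (RatFunc.C r) = (r : Qxy) by
      rw [eq_ratCast (RatFunc.C : ℚ →+* Qx), map_ratCast]]
    exact SubfieldClass.ratCast_mem _ r
  have : a ∈ (Subfield.closure {x, y}).comap (RatFunc.C : Qx →+* Qxy) := h ▸ Subfield.mem_top a
  exact this

/-- The expansion of rational functions in `ℚ((x))((y))`. -/
def expandXY : Qxy →+* LXY :=
  (laurentMapHom (ratFuncToLaurent ℚ)).comp (ratFuncToLaurent Qx)

theorem coeff_expandXY (i j : ℤ) (f : Qxy) :
    ((expandXY f).coeff j).coeff i = coeffXY i j f := rfl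

theorem expandXY_x : expandXY x = kvar 0 := by
  rw [expandXY, x, RingHom.comp_apply, ratFuncToLaurent_C, HahnSeries.C_apply,
    laurentMapHom_single, ratFuncToLaurent_X]
  rfl

theorem expandXY_y : expandXY y = kvar 1 := by
  rw [expandXY, y, RingHom.comp_apply, ratFuncToLaurent_X, laurentMapHom_single, map_one]
  rfl

/-- An element of `ℚ((x))((y))[[u, v, t]]` is rational if it is a quotient of polynomials in
`x, y, u, v, t`. -/
def IsRational (F : LXYuvt) : Prop :=
  ∃ D p : MvPolynomial (Fin 2 ⊕ Fin 3) ℚ, MvPolynomial.aeval lvar D ≠ 0 ∧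
    MvPolynomial.aeval lvar D * F = MvPolynomial.aeval lvar p

theorem isRational_aeval (p : MvPolynomial (Fin 2 ⊕ Fin 3) ℚ) :
    IsRational (MvPolynomial.aeval lvar p) := ⟨1, p, by simp, by simp⟩

theorem IsRational.mul {F G : LXYuvt} (hF : IsRational F) (hG : IsRational G) :
    IsRational (F * G) := by
  obtain ⟨D, p, hD, h⟩ := hF
  obtain ⟨E, q, hE, h'⟩ := hG
  refine ⟨D * E, p * q, ?_, ?_⟩
  · rw [map_mul]; exact mul_ne_zero hD hE
  · rw [map_mul, map_mul, ← h, ← h']; ring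

theorem IsRational.sub {F G : LXYuvt} (hF : IsRational F) (hG : IsRational G) :
    IsRational (F - G) := by
  obtain ⟨D, p, hD, h⟩ := hF
  obtain ⟨E, q, hE, h'⟩ := hG
  refine ⟨D * E, p * E - D * q, ?_, ?_⟩
  · rw [map_mul]; exact mul_ne_zero hD hE
  · rw [map_mul, map_sub, map_mul, map_mul, ← h, ← h']; ring

theorem IsRational.of_mul_left {F G : LXYuvt} (hF : IsRational F) (hF0 : F ≠ 0)
    (h : IsRational (F * G)) : IsRational G := by
  obtain ⟨D, p, hD, hF⟩ := hF
  obtain ⟨E, q, hE, h⟩ := h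
  refine ⟨p * E, D * q, ?_, ?_⟩
  · rw [map_mul, ← hF]; exact mul_ne_zero (mul_ne_zero hD hF0) hE
  · rw [map_mul, map_mul, ← hF, ← h]; ring

theorem isRational_expandXY (f : Qxy) : IsRational (MvPowerSeries.C (expandXY f)) := by
  have hf : f ∈ Subfield.closure {x, y} := subfield_closure_xy ▸ Subfield.mem_top f
  have h1 : IsRational 1 := by simpa using isRational_aeval 1
  have h0 : IsRational 0 := by simpa using isRational_aeval 0
  induction hf using Subfield.closure_induction with
  | mem f hf =>
    rcases hf with rfl | rfl
    · rw [expandXY_x]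
      simpa [lvar] using isRational_aeval (MvPolynomial.X (Sum.inl 0))
    · rw [expandXY_y]
      simpa [lvar] using isRational_aeval (MvPolynomial.X (Sum.inl 1))
  | one => rwa [map_one, map_one]
  | add f g _ _ hf hg =>
    rw [map_add, map_add]
    have := hf.sub (h0.sub hg)
    rwa [zero_sub, sub_neg_eq_add] at this
  | neg f _ hf =>
    rw [map_neg, map_neg]
    have := h0.sub hf
    rwa [zero_sub] at this
  | inv f _ hf =>
    rcases eq_or_ne f 0 with rfl | hne
    · rw [inv_zero, map_zero, map_zero]; exact h0
    · refine hf.of_mul_left ?_ ?_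
      · rw [Ne, map_eq_zero_iff _ MvPowerSeries.C_injective, map_eq_zero]
        exact hne
      · rw [← map_mul, ← map_mul, mul_inv_cancel₀ hne, map_one, map_one]
        exact h1
  | mul f g _ _ hf hg => rw [map_mul, map_mul]; exact hf.mul hg

/-- The geometric series with ratio `a` in one variable. -/
theorem one_sub_C_mul_X_mul {K : Type*} [CommRing K] {σ : Type*} [DecidableEq σ] (a : K) (i : σ)
    (F : MvPowerSeries σ K)
    (hF : ∀ m : σ →₀ ℕ, F (m + Finsupp.single i 1) = a * F m) (m : σ →₀ ℕ) :
    MvPowerSeries.coeff m ((1 - MvPowerSeries.C a * MvPowerSeries.X i) * F) =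
      if m i = 0 then MvPowerSeries.coeff m F else 0 := by
  rw [sub_mul, one_mul, map_sub, mul_assoc, MvPowerSeries.coeff_C_mul, MvPowerSeries.X,
    MvPowerSeries.coeff_monomial_mul, one_mul]
  have hle : Finsupp.single i 1 ≤ m ↔ m i ≠ 0 := by
    rw [Finsupp.single_le_iff]; omega
  by_cases h : m i = 0
  · simp [hle, h]
  · rw [if_pos (hle.2 h), if_neg h, sub_eq_zero]
    have := hF (m - Finsupp.single i 1)
    rw [tsub_add_cancel_of_le (hle.2 h)] at this
    exact this

/-- The generating function of the coefficients of `x ^ i * y ^ j` with `i, j > 0` in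
`O * T ^ n` is D-finite for all rational functions `O` and `T`. -/
theorem isDFinite_coeffXY (O T : Qxy) :
    IsDFinite (fun m : Fin 3 →₀ ℕ => coeffXY (m 0 + 1) (m 1 + 1) (O * T ^ m 2)) := by
  classical
  -- `G` expands `O x⁻² y⁻² / ((1 - u/x)(1 - v/y)(1 - tT))`. In its coefficient of `u^i v^j t^n`,
  -- the residue reads off `x^(i+1) y^(j+1)` in `O * T^n`; the squares account for `i + 1 = -1 + (i
  -- + 2)`.
  set c : Fin 3 → Qxy := ![x⁻¹, y⁻¹, T] with hc
  set G : LXYuvt := fun m => expandXY (O * x⁻¹ ^ 2 * y⁻¹ ^ 2 * ∏ i, c i ^ m i) with hG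
  have hrec : ∀ (i : Fin 3) (m : Fin 3 →₀ ℕ),
      G (m + Finsupp.single i 1) = expandXY (c i) * G m := fun i m => by
    simp only [hG]
    rw [← map_mul]
    congr 1
    simp only [Finsupp.add_apply, pow_add, Finset.prod_mul_distrib]
    rw [Finset.prod_eq_single (f := fun j => c j ^ (Finsupp.single i 1 : Fin 3 →₀ ℕ) j) i]
    · simp; ring
    · intro j _ hj; simp [hj.symm]
    · simp
  -- Each denominator factor removes the terms that contain its variable, so all three together
  -- leave the constant term of `G`, which is rational.
  have hprod : ∀ s : Finset (Fin 3), ∀ m,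
      MvPowerSeries.coeff m ((∏ i ∈ s, (1 - MvPowerSeries.C (expandXY (c i)) *
        MvPowerSeries.X i)) * G) = if ∀ i ∈ s, m i = 0 then G m else 0 := by
    intro s
    induction s using Finset.induction_on with
    | empty => intro m; simp; rfl
    | insert i s hi ih =>
      intro m
      rw [Finset.prod_insert hi, mul_assoc, one_sub_C_mul_X_mul, ih]
      · simp only [Finset.forall_mem_insert]
        split_ifs <;> tauto
      · intro m
        have h1 := ih (m + Finsupp.single i 1)
        have h2 := ih m
        have h3 : (∀ j ∈ s, (m + Finsupp.single i 1 : Fin 3 →₀ ℕ) j = 0) ↔ ∀ j ∈ s, m j = 0 := by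
          refine forall₂_congr fun j hj => ?_
          have : i ≠ j := fun h => hi (h ▸ hj)
          simp [this.symm]
        simp only [h3, hrec] at h1
        refine Eq.trans h1 ?_
        refine Eq.trans ?_ (congrArg (expandXY (c i) * ·) h2.symm)
        split_ifs <;> simp
  have hfac : ∀ i, IsRational (1 - MvPowerSeries.C (expandXY (c i)) * MvPowerSeries.X i) ∧
      (1 - MvPowerSeries.C (expandXY (c i)) * MvPowerSeries.X i : LXYuvt) ≠ 0 := fun i => by
    refine ⟨?_, fun h => ?_⟩
    · have h1 : IsRational 1 := by simpa using isRational_aeval 1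
      have h2 : IsRational (MvPowerSeries.X i) := by
        simpa [lvar] using isRational_aeval (MvPolynomial.X (Sum.inr i))
      exact h1.sub ((isRational_expandXY _).mul h2)
    · have := congrArg MvPowerSeries.constantCoeff h
      simp at this
  have huniv : IsRational ((∏ i, (1 - MvPowerSeries.C (expandXY (c i)) *
      MvPowerSeries.X i)) * G) := by
    convert isRational_expandXY (O * x⁻¹ ^ 2 * y⁻¹ ^ 2) using 1
    ext m
    rw [hprod, MvPowerSeries.coeff_C]
    have h : (∀ i ∈ Finset.univ, m i = 0) ↔ m = 0 := by simp [Finsupp.ext_iff]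
    simp only [h]
    split_ifs with hm
    · simp [hG, hm]
    · rfl
  rw [Fin.prod_univ_three, mul_assoc, mul_assoc] at huniv
  obtain ⟨D, p, hD, h⟩ := (hfac 2).1.of_mul_left (hfac 2).2
    ((hfac 1).1.of_mul_left (hfac 1).2 ((hfac 0).1.of_mul_left (hfac 0).2 huniv))
  suffices hres : lcoeff (-1) (-1) G =
      fun m => coeffXY (m 0 + 1) (m 1 + 1) (O * T ^ m 2) from
    hres ▸ isDFinite_lcoeff D p hD G h
  funext m
  change ((G m).coeff (-1)).coeff (-1) = _
  have h1 : G m = HahnSeries.C (HahnSeries.single (-(m 0 + 2 : ℤ)) 1) *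
      (HahnSeries.single (-(m 1 + 2 : ℤ)) 1 * expandXY (O * T ^ m 2)) := by
    have hx : ∀ n : ℕ, HahnSeries.C (HahnSeries.single (-(n + 2 : ℤ)) 1) =
        expandXY (x⁻¹ ^ (n + 2)) := fun n => by
      rw [map_pow, map_inv₀, expandXY_x, kvar_zero, ← map_inv₀, ← map_pow, HahnSeries.inv_single,
        HahnSeries.single_pow, inv_one, one_pow]
      congr 2
      simp
    have hy : ∀ n : ℕ, HahnSeries.single (-(n + 2 : ℤ)) 1 = expandXY (y⁻¹ ^ (n + 2)) := fun n => by
      rw [map_pow, map_inv₀, expandXY_y, kvar_one, HahnSeries.inv_single,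
        HahnSeries.single_pow, inv_one, one_pow]
      congr 1
      simp
    rw [hx, hy, ← map_mul, ← map_mul]
    simp only [hG, Fin.prod_univ_three]
    rw [show c 0 = x⁻¹ from rfl, show c 1 = y⁻¹ from rfl, show c 2 = T from rfl]
    congr 1
    ring
  rw [h1, HahnSeries.C_apply, HahnSeries.coeff_single_zero_mul, HahnSeries.coeff_single_mul,
    HahnSeries.coeff_single_mul, one_mul, one_mul, coeff_expandXY]
  congr 1 <;> ring

end RationalFunctions

/-! ### Automorphisms of `ℚ(x, y)` from pairs of generators -/

section Automorphisms

theorem two_le_trdeg : 2 ≤ Algebra.trdeg ℚ Qxy := by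
  have : @IsScalarTower ℚ Qx Qxy Algebra.toSMul Algebra.toSMul Algebra.toSMul :=
    IsScalarTower.of_algebraMap_eq' (R := ℚ) (S := Qx) (A := Qxy) (Subsingleton.elim _ _)
  have h1 : Algebra.Transcendental ℚ Qx := by
    convert RatFunc.transcendental (K := ℚ)
    exact Subsingleton.elim _ _
  have h2 := lift_trdeg_add_eq (R := ℚ) (S := Qx) (A := Qxy)
  simp only [Cardinal.lift_id] at h2
  rw [← h2, ← one_add_one_eq_two]
  exact add_le_add (Cardinal.one_le_iff_pos.2 (trdeg_pos ℚ Qx))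
    (Cardinal.one_le_iff_pos.2 (trdeg_pos Qx Qxy))

theorem adjoin_eq_top {a b : Qxy} (hx : x ∈ Subfield.closure {a, b})
    (hy : y ∈ Subfield.closure {a, b}) :
    IntermediateField.adjoin ℚ (Set.range ![a, b]) = ⊤ := by
  have h : Subfield.closure {a, b} = ⊤ := by
    rw [← top_le_iff, ← subfield_closure_xy, Subfield.closure_le]
    rintro _ (rfl | rfl) <;> assumption
  refine top_le_iff.1 fun f _ => ?_
  have hf : f ∈ Subfield.closure {a, b} := h ▸ Subfield.mem_top f
  refine (Subfield.closure_le (t := (IntermediateField.adjoin ℚ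
    (Set.range ![a, b])).toSubfield)).2 ?_ hf
  rintro _ (rfl | rfl)
  · exact IntermediateField.subset_adjoin _ _ ⟨0, rfl⟩
  · exact IntermediateField.subset_adjoin _ _ ⟨1, rfl⟩

-- `ℚ(x, y)` is algebraic over the ring generated by `a, b` and has transcendence degree at least 2,
-- so a generating pair is a transcendence basis.
open scoped IntermediateField.algebraAdjoinAdjoin in
theorem algebraicIndependent_pair {a b : Qxy} (hx : x ∈ Subfield.closure {a, b})
    (hy : y ∈ Subfield.closure {a, b}) : AlgebraicIndependent ℚ ![a, b] := by
  have htop := adjoin_eq_top hx hy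
  have halg : Algebra.IsAlgebraic (Algebra.adjoin ℚ (Set.range ![a, b])) Qxy := by
    have h1 : Algebra.IsAlgebraic (Algebra.adjoin ℚ (Set.range ![a, b]))
        (IntermediateField.adjoin ℚ (Set.range ![a, b])) :=
      IsLocalization.isAlgebraic _ (nonZeroDivisors _)
    refine ⟨fun f => ?_⟩
    have hf : f ∈ IntermediateField.adjoin ℚ (Set.range ![a, b]) := htop ▸ IntermediateField.mem_top
    exact IsAlgebraic.algebraMap (A := Qxy) (h1.isAlgebraic ⟨f, hf⟩)
  have : @FaithfulSMul ℚ Qxy Algebra.toSMul :=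
    (faithfulSMul_iff_algebraMap_injective ℚ Qxy).2 (algebraMap ℚ Qxy).injective
  exact (Algebra.IsAlgebraic.isTranscendenceBasis_of_le_trdeg_of_finite ℚ ![a, b]
    (by simpa using two_le_trdeg)).1

theorem exists_ringEquiv_fractionRing {F E ι : Type*} [Field F] [Field E] [Algebra F E] {v : ι → E}
    (hv : AlgebraicIndependent F v) (htop : IntermediateField.adjoin F (Set.range v) = ⊤) :
    ∃ g : FractionRing (MvPolynomial ι F) ≃+* E,
      ∀ i, g (algebraMap (MvPolynomial ι F) _ (MvPolynomial.X i)) = v i := by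
  refine ⟨hv.aevalEquivField.toRingEquiv.trans
    (((IntermediateField.equivOfEq htop).trans IntermediateField.topEquiv).toRingEquiv),
    fun i => ?_⟩
  have := hv.aevalEquivField_algebraMap_apply_coe (MvPolynomial.X i)
  rw [MvPolynomial.aeval_X] at this
  exact this

/-- Two rational functions that generate `ℚ(x, y)` are the images of `x` and `y` under an
automorphism. -/
theorem exists_ringAut {a b : Qxy} (hx : x ∈ Subfield.closure {a, b})
    (hy : y ∈ Subfield.closure {a, b}) : ∃ g : RingAut Qxy, g x = a ∧ g y = b := by
  have e : ∀ {a b : Qxy} (_ : x ∈ Subfield.closure {a, b}) (_ : y ∈ Subfield.closure {a, b}),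
      ∃ g : FractionRing (MvPolynomial (Fin 2) ℚ) ≃+* Qxy,
        g (algebraMap (MvPolynomial (Fin 2) ℚ) _ (MvPolynomial.X 0)) = a ∧
        g (algebraMap (MvPolynomial (Fin 2) ℚ) _ (MvPolynomial.X 1)) = b := by
    intro a b hx hy
    obtain ⟨g, hg⟩ := exists_ringEquiv_fractionRing (algebraicIndependent_pair hx hy)
      (adjoin_eq_top hx hy)
    exact ⟨g, hg 0, hg 1⟩
  obtain ⟨g, h1, h2⟩ := e hx hy
  obtain ⟨g', h3, h4⟩ := e (a := x) (b := y) (Subfield.subset_closure (by simp))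
    (Subfield.subset_closure (by simp))
  refine ⟨g'.symm.trans g, ?_, ?_⟩
  · change g (g'.symm x) = a
    rw [← h1, ← h3, g'.symm_apply_apply]
  · change g (g'.symm y) = b
    rw [← h2, ← h4, g'.symm_apply_apply]

theorem ringAut_ext {g g' : RingAut Qxy} (hx : g x = g' x) (hy : g y = g' y) : g = g' := by
  have h : RingHom.eqLocusField (g : Qxy →+* Qxy) (g' : Qxy →+* Qxy) = ⊤ := by
    rw [← top_le_iff, ← subfield_closure_xy, Subfield.closure_le]
    rintro _ (rfl | rfl) <;> assumption
  ext f
  have : f ∈ RingHom.eqLocusField (g : Qxy →+* Qxy) (g' : Qxy →+* Qxy) := h ▸ Subfield.mem_top f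
  exact this

end Automorphisms

/-! ### Groups generated by two involutions -/

section Dihedral

open Classical in
/-- The sign of an element of a group generated by `T`: `1` if it is the product of an even
number of generators, and `-1` otherwise. -/
def wordSign {H : Type*} [Group H] (T : Set H) (g : H) : ℤ :=
  if ∃ l : List H, (∀ h ∈ l, h ∈ T) ∧ Even l.length ∧ l.prod = g then 1 else -1

variable {H : Type*} [Group H] {a b : H} {m : ℕ}

theorem mul_zpow_comm_of_involutions (ha : a * a = 1) (hb : b * b = 1) (i : ℤ) :
    a * (a * b) ^ i = (a * b) ^ (-i) * a := by
  have ha' : a⁻¹ = a := inv_eq_of_mul_eq_one_left ha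
  have hb' : b⁻¹ = b := inv_eq_of_mul_eq_one_left hb
  have h1 : a * (a * b) * a⁻¹ = (a * b)⁻¹ := by
    rw [mul_inv_rev, ha', hb', ← mul_assoc, ha, one_mul]
  have h2 : a * (a * b) ^ i * a⁻¹ = (a * b) ^ (-i) := by
    rw [← conj_zpow, h1, inv_zpow, zpow_neg]
  rw [← h2, inv_mul_cancel_right]

theorem right_eq_of_involutions (ha : a * a = 1) (hb : b * b = 1) :
    b = (a * b) ^ (-1 : ℤ) * a := by
  rw [← mul_zpow_comm_of_involutions ha hb, zpow_one, ← mul_assoc, ha, one_mul]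

/-- Since `b = (ab)⁻¹ a` and `a` inverts `ab` by conjugation, every word has a normal form as a
rotation or a reflection, decided by the parity of its length. -/
theorem list_prod_of_involutions (ha : a * a = 1) (hb : b * b = 1) (l : List H)
    (hl : ∀ h ∈ l, h ∈ ({a, b} : Set H)) :
    ∃ i : ℤ, l.prod = (a * b) ^ i * if Even l.length then 1 else a := by
  induction l with
  | nil => exact ⟨0, by simp⟩
  | cons h l ih =>
    obtain ⟨i, hi⟩ := ih fun g hg => hl g (List.mem_cons_of_mem _ hg)
    have h1 : ∀ j : ℤ, (a * b) ^ j * a * l.prod =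
        (a * b) ^ (j - i) * if Even (h :: l).length then 1 else a := fun j => by
      simp only [List.length_cons, Nat.even_add_one]
      rw [hi, mul_assoc, ← mul_assoc a, mul_zpow_comm_of_involutions ha hb, sub_eq_add_neg,
        zpow_add]
      split_ifs with hev
      · simp [mul_assoc]
      · simp [mul_assoc, ha]
    have h2 := hl h List.mem_cons_self
    rw [List.prod_cons]
    rcases h2 with rfl | rfl
    · have h0 := h1 0
      rw [zpow_zero, one_mul] at h0
      exact ⟨0 - i, h0⟩
    · refine ⟨-1 - i, Eq.trans ?_ (h1 (-1))⟩
      rw [← right_eq_of_involutions ha hb]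

/-- Otherwise `a` is a power of `ab` and commutes with it; as it also inverts it, `(ab)² = 1`. An
even power then gives `a = 1`, an odd one `b = 1`. -/
theorem reflection_not_rotation (ha : a * a = 1) (hb : b * b = 1) (ha1 : a ≠ 1) (hb1 : b ≠ 1)
    (i j : ℤ) : (a * b) ^ i ≠ (a * b) ^ j * a := by
  intro h
  have h1 : a = (a * b) ^ (i - j) := by
    rw [sub_eq_neg_add, zpow_add, h, zpow_neg, inv_mul_cancel_left]
  have h2 : (a * b) * (a * b) = 1 := by
    have h3 : a * (a * b) = (a * b) ^ (-1 : ℤ) * a := by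
      simpa using mul_zpow_comm_of_involutions ha hb 1
    have h4 : a * (a * b) = (a * b) * a := by
      conv_lhs => rw [h1]
      conv_rhs => rw [h1]
      rw [← h1]
      generalize a * b = c at h1 ⊢
      rw [h1, ← zpow_add_one, ← zpow_one_add, add_comm]
    rw [h4, mul_left_inj, zpow_neg_one] at h3
    nth_rewrite 1 [h3]
    exact inv_mul_cancel _
  rcases Int.even_or_odd' (i - j) with ⟨k, hk | hk⟩
  · apply ha1
    rw [h1, hk, zpow_mul, zpow_ofNat, pow_two, h2, one_zpow]
  · apply hb1
    refine (right_eq_of_involutions ha hb).trans ((congrArg ((a * b) ^ (-1 : ℤ) * ·) h1).trans ?_)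
    rw [hk, ← zpow_add, neg_add_cancel_comm_assoc, zpow_mul, zpow_ofNat, pow_two, h2, one_zpow]

theorem mem_closure_of_involutions (ha : a * a = 1) (hb : b * b = 1) {g : H} :
    g ∈ Subgroup.closure {a, b} ↔ ∃ i : ℤ, g = (a * b) ^ i ∨ g = (a * b) ^ i * a := by
  constructor
  · intro hg
    have hg' : g ∈ Submonoid.closure ({a, b} ∪ {a, b}⁻¹ : Set H) := by
      rw [← Subgroup.closure_toSubmonoid]; exact hg
    obtain ⟨l, hl, rfl⟩ := Submonoid.exists_list_of_mem_closure hg'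
    have hl' : ∀ h ∈ l, h ∈ ({a, b} : Set H) := fun h hh => by
      rcases hl h hh with h1 | h1
      · exact h1
      · have ha' : a⁻¹ = a := inv_eq_of_mul_eq_one_left ha
        have hb' : b⁻¹ = b := inv_eq_of_mul_eq_one_left hb
        rcases h1 with h1 | h1
        · left; rw [← ha', ← h1, inv_inv]
        · right; rw [Set.mem_singleton_iff, ← hb', ← Set.mem_singleton_iff.1 h1, inv_inv]
    obtain ⟨i, hi⟩ := list_prod_of_involutions ha hb l hl'
    refine ⟨i, ?_⟩
    split_ifs at hi
    · left; simpa using hi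
    · right; exact hi
  · have h1 : a ∈ Subgroup.closure {a, b} := Subgroup.subset_closure (by simp)
    have h2 : b ∈ Subgroup.closure {a, b} := Subgroup.subset_closure (by simp)
    rintro ⟨i, rfl | rfl⟩
    · exact zpow_mem (mul_mem h1 h2) i
    · exact mul_mem (zpow_mem (mul_mem h1 h2) i) h1

theorem wordSign_rotation (n : ℕ) : wordSign {a, b} ((a * b) ^ n) = 1 := by
  rw [wordSign, if_pos]
  refine ⟨(List.replicate n [a, b]).flatten, fun h hh => ?_, ?_, ?_⟩
  · obtain ⟨l, hl, hh⟩ := List.mem_flatten.1 hh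
    rw [List.eq_of_mem_replicate hl] at hh
    simpa using hh
  · simp
  · simp [List.prod_flatten]

theorem wordSign_reflection (ha : a * a = 1) (hb : b * b = 1) (ha1 : a ≠ 1) (hb1 : b ≠ 1)
    (n : ℕ) : wordSign {a, b} ((a * b) ^ n * a) = -1 := by
  rw [wordSign, if_neg]
  rintro ⟨l, hl, hev, hprod⟩
  obtain ⟨i, hi⟩ := list_prod_of_involutions ha hb l hl
  rw [if_pos hev, mul_one, hprod, ← zpow_natCast] at hi
  exact reflection_not_rotation ha hb ha1 hb1 _ _ hi.symm

open Classical in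
theorem closure_of_involutions (ha : a * a = 1) (hb : b * b = 1) (hm : 0 < m)
    (hord : orderOf (a * b) = m) :
    (Subgroup.closure {a, b} : Set H) =
      ↑((Finset.range m).image (fun i => (a * b) ^ i) ∪
        (Finset.range m).image (fun i => (a * b) ^ i * a)) := by
  have hmod : ∀ i : ℤ, ∃ n < m, (a * b) ^ i = (a * b) ^ n := fun i => by
    refine ⟨(i % m).toNat, ?_, ?_⟩
    · have := Int.emod_lt_of_pos i (by exact_mod_cast hm : (0 : ℤ) < m)
      have := Int.emod_nonneg i (by exact_mod_cast hm.ne' : (m : ℤ) ≠ 0)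
      omega
    · rw [← zpow_natCast, Int.toNat_of_nonneg (Int.emod_nonneg i (by exact_mod_cast hm.ne')),
        ← hord, zpow_mod_orderOf]
  ext g
  simp only [SetLike.mem_coe, mem_closure_of_involutions ha hb, Finset.coe_union, Finset.coe_image,
    Finset.coe_range, Set.mem_union, Set.mem_image, Set.mem_Iio]
  constructor
  · rintro ⟨i, rfl | rfl⟩
    · obtain ⟨n, hn, h⟩ := hmod i
      exact Or.inl ⟨n, hn, h.symm⟩
    · obtain ⟨n, hn, h⟩ := hmod i
      exact Or.inr ⟨n, hn, by rw [h]⟩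
  · rintro (⟨n, -, rfl⟩ | ⟨n, -, rfl⟩)
    · exact ⟨n, Or.inl (zpow_natCast _ _).symm⟩
    · exact ⟨n, Or.inr (by rw [zpow_natCast])⟩

theorem finite_closure_of_involutions (ha : a * a = 1) (hb : b * b = 1) (hm : 0 < m)
    (hord : orderOf (a * b) = m) : Finite (Subgroup.closure {a, b}) := by
  classical
  change Finite ((Subgroup.closure {a, b} : Subgroup H) : Set H)
  rw [closure_of_involutions ha hb hm hord]
  exact Finset.finite_toSet _

/-- The signed sum over a finite dihedral group. -/
theorem finsum_wordSign (ha : a * a = 1) (hb : b * b = 1) (ha1 : a ≠ 1) (hb1 : b ≠ 1)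
    (hm : 0 < m) (hord : orderOf (a * b) = m) {F : Type*} [Ring F] (f : H → F) :
    ∑ᶠ g : Subgroup.closure {a, b}, (wordSign {a, b} (g : H) : F) * f g =
      ∑ i ∈ Finset.range m, (f ((a * b) ^ i) - f ((a * b) ^ i * a)) := by
  classical
  have h1 := finsum_set_coe_eq_finsum_mem (f := fun g => (wordSign {a, b} g : F) * f g)
    (Subgroup.closure {a, b} : Set H)
  refine h1.trans ?_
  have hinj : Set.InjOn (fun i => (a * b) ^ i) (Finset.range m : Set ℕ) := by
    rw [← hord, Finset.coe_range]
    exact pow_injOn_Iio_orderOf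
  rw [closure_of_involutions ha hb hm hord, finsum_mem_coe_finset, Finset.sum_union, Finset.sum_image hinj, Finset.sum_image,
    Finset.sum_sub_distrib, sub_eq_add_neg, ← Finset.sum_neg_distrib]
  · congr 1
    · refine Finset.sum_congr rfl fun i _ => ?_
      rw [wordSign_rotation, Int.cast_one, one_mul]
    · refine Finset.sum_congr rfl fun i _ => ?_
      rw [wordSign_reflection ha hb ha1 hb1, Int.cast_neg, Int.cast_one, neg_one_mul]
  · intro i hi j hj h
    exact hinj hi hj (mul_right_cancel h)
  · rw [Finset.disjoint_left]
    intro g h3 h4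
    obtain ⟨i, -, rfl⟩ := Finset.mem_image.1 h3
    obtain ⟨j, -, h⟩ := Finset.mem_image.1 h4
    have := reflection_not_rotation ha hb ha1 hb1 i j
    rw [zpow_natCast, zpow_natCast] at this
    exact this h.symm

end Dihedral

/-! ### Weighted walks and the reflection principle -/

section Counting

open Classical in
/-- The weighted number of walks with steps in `𝒮` that stay in the domain `D` after each step,
where the starting points carry the weights `z`. -/
def walkWeight (𝒮 : Finset (ℤ × ℤ)) (D : ℤ × ℤ → Prop) (z : ℤ × ℤ → ℚ) : ℕ → ℤ × ℤ → ℚ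
  | 0, p => if D p then z p else 0
  | n + 1, p => if D p then ∑ s ∈ 𝒮, walkWeight 𝒮 D z n (p - s) else 0

variable {𝒮 : Finset (ℤ × ℤ)} {D : ℤ × ℤ → Prop} {z : ℤ × ℤ → ℚ}

theorem walkWeight_of_not (n : ℕ) {p : ℤ × ℤ} (hp : ¬ D p) : walkWeight 𝒮 D z n p = 0 := by
  cases n <;> simp [walkWeight, hp]

theorem walkWeight_zero {p : ℤ × ℤ} (hp : D p) : walkWeight 𝒮 D z 0 p = z p := by
  simp [walkWeight, hp]

theorem walkWeight_succ (n : ℕ) {p : ℤ × ℤ} (hp : D p) :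
    walkWeight 𝒮 D z (n + 1) p = ∑ s ∈ 𝒮, walkWeight 𝒮 D z n (p - s) := by
  simp [walkWeight, hp]

/-- The reflection principle: weights that are antisymmetric under a symmetry of the steps remain
antisymmetric. -/
theorem walkWeight_antisymm (τ : ℤ × ℤ →+ ℤ × ℤ) (hτ : ∀ p, τ (τ p) = p)
    (h𝒮 : ∀ s ∈ 𝒮, τ s ∈ 𝒮) (hD : ∀ p, D (τ p) ↔ D p) (hz : ∀ p, z (τ p) = -z p) (n : ℕ)
    (p : ℤ × ℤ) : walkWeight 𝒮 D z n (τ p) = -walkWeight 𝒮 D z n p := by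
  induction n generalizing p with
  | zero =>
    by_cases hp : D p
    · rw [walkWeight_zero hp, walkWeight_zero ((hD p).2 hp), hz]
    · rw [walkWeight_of_not _ hp, walkWeight_of_not _ fun h => hp ((hD p).1 h), neg_zero]
  | succ n ih =>
    by_cases hp : D p
    · rw [walkWeight_succ _ hp, walkWeight_succ _ ((hD p).2 hp), ← Finset.sum_neg_distrib]
      refine Finset.sum_bij' (fun s _ => τ s) (fun s _ => τ s) h𝒮 h𝒮 (fun s _ => hτ s)
        (fun s _ => hτ s) fun s _ => ?_
      rw [← ih, map_sub, hτ]
    · rw [walkWeight_of_not _ hp, walkWeight_of_not _ fun h => hp ((hD p).1 h), neg_zero]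

/-- Weights that vanish on the boundary of a smaller domain restrict to this domain. -/
theorem walkWeight_restrict {D' : ℤ × ℤ → Prop} {z' : ℤ × ℤ → ℚ} (hD : ∀ p, D' p → D p)
    (hz : ∀ p, D' p → z' p = z p)
    (hbd : ∀ n p, D' p → ∀ s ∈ 𝒮, ¬ D' (p - s) → walkWeight 𝒮 D z n (p - s) = 0) (n : ℕ)
    {p : ℤ × ℤ} (hp : D' p) : walkWeight 𝒮 D' z' n p = walkWeight 𝒮 D z n p := by
  induction n generalizing p with
  | zero => rw [walkWeight_zero hp, walkWeight_zero (hD p hp), hz p hp]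
  | succ n ih =>
    rw [walkWeight_succ _ hp, walkWeight_succ _ (hD p hp)]
    refine Finset.sum_congr rfl fun s hs => ?_
    by_cases h : D' (p - s)
    · exact ih h
    · rw [walkWeight_of_not _ h, hbd n p hp s hs h]

theorem walks_last {n : ℕ} {w : Fin n → ℤ × ℤ} (hw : w ∈ walks 𝒮 n) : 0 ≤ ∑ k, w k := by
  have h := (Finset.mem_filter.1 hw).2 (Fin.last n)
  simpa using h

theorem snoc_mem_walks {n : ℕ} (w : Fin n → ℤ × ℤ) (s : ℤ × ℤ) :
    (Fin.snoc w s : Fin (n + 1) → ℤ × ℤ) ∈ walks 𝒮 (n + 1) ↔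
      w ∈ walks 𝒮 n ∧ s ∈ 𝒮 ∧ 0 ≤ ∑ k, w k + s := by
  have h1 : (∀ k : Fin (n + 1), (Fin.snoc w s : Fin (n + 1) → ℤ × ℤ) k ∈ 𝒮) ↔
      (∀ k, w k ∈ 𝒮) ∧ s ∈ 𝒮 := by
    simp only [Fin.forall_fin_succ', Fin.snoc_castSucc, Fin.snoc_last]
  have h2 : ∀ m : Fin (n + 1), (∑ k : Fin (n + 1) with k.val < (Fin.castSucc m).val,
      (Fin.snoc w s : Fin (n + 1) → ℤ × ℤ) k) = ∑ k : Fin n with k.val < m.val, w k := fun m => by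
    rw [Finset.sum_filter, Fin.sum_univ_castSucc, Finset.sum_filter]
    simp only [Fin.snoc_castSucc, Fin.snoc_last, Fin.val_castSucc, Fin.val_last]
    rw [if_neg (by omega), add_zero]
  have h3 : (∑ k : Fin (n + 1) with k.val < (Fin.last (n + 1)).val,
      (Fin.snoc w s : Fin (n + 1) → ℤ × ℤ) k) = ∑ k, w k + s := by
    rw [Finset.filter_true_of_mem fun k _ => k.2, Fin.sum_univ_castSucc]
    simp only [Fin.snoc_castSucc, Fin.snoc_last]
  simp only [walks, Finset.mem_filter, Fintype.mem_piFinset, h1,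
    Fin.forall_fin_succ' (n := n + 1), h2, h3]
  tauto

/-- The number of quarter plane walks that end at a point of the plane. -/
theorem q_eq_walkWeight (i j n : ℕ) : (q 𝒮 i j n : ℚ) =
    walkWeight 𝒮 (fun p => 1 ≤ p.1 ∧ 1 ≤ p.2) (fun p => if p = (1, 1) then 1 else 0) n
      (i + 1, j + 1) := by
  classical
  -- The induction needs all points of the plane, because a predecessor `p - s` may lie outside the
  -- quadrant.
  suffices h : ∀ p : ℤ × ℤ, ((({w ∈ walks 𝒮 n | ∑ k, w k = p} : Finset _).card : ℕ) : ℚ) =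
      walkWeight 𝒮 (fun p => 1 ≤ p.1 ∧ 1 ≤ p.2) (fun p => if p = (1, 1) then 1 else 0) n
        (p + (1, 1)) from h (i, j)
  induction n with
  | zero =>
    intro p
    by_cases hp : p = 0
    · subst hp
      rw [walkWeight_zero ⟨by simp, by simp⟩, if_pos (zero_add _)]
      have h : ({w ∈ walks 𝒮 0 | ∑ k, w k = 0} : Finset _) = Finset.univ := by
        ext w
        simp [walks]
      rw [h]
      simp
    · have h : ({w ∈ walks 𝒮 0 | ∑ k, w k = p} : Finset _) = ∅ := by
        refine Finset.filter_false_of_mem fun w _ => ?_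
        simpa using Ne.symm hp
      rw [h, walkWeight]
      simp [hp]
  | succ n ih =>
    intro p
    by_cases hp : 0 ≤ p
    · have hp' : 1 ≤ (p + (1, 1)).1 ∧ 1 ≤ (p + (1, 1)).2 := by
        have h1 := hp.1
        have h2 := hp.2
        simp at h1 h2 ⊢
        exact ⟨h1, h2⟩
      rw [walkWeight_succ _ hp', Finset.card_eq_sum_card_fiberwise (f := fun w => w (Fin.last n))
        (t := 𝒮), Nat.cast_sum]
      · refine Finset.sum_congr rfl fun s hs => ?_
        rw [add_sub_right_comm, ← ih]
        congr 1
        refine Finset.card_bij' (fun w _ => Fin.init w) (fun w _ => Fin.snoc w s) ?_ ?_ ?_ ?_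
        · intro w hw
          simp only [Finset.mem_filter] at hw ⊢
          obtain ⟨⟨hw, hsum⟩, rfl⟩ := hw
          rw [← Fin.snoc_init_self w, snoc_mem_walks] at hw
          refine ⟨hw.1, ?_⟩
          rw [← hsum, Fin.sum_univ_castSucc, add_sub_cancel_right]
          rfl
        · intro w hw
          simp only [Finset.mem_filter] at hw ⊢
          have hsum : ∑ k, w k + s = p := by rw [hw.2, sub_add_cancel]
          refine ⟨⟨(snoc_mem_walks w s).2 ⟨hw.1, hs, by rw [hsum]; exact hp⟩, ?_⟩,
            Fin.snoc_last _ _⟩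
          rw [Fin.sum_univ_castSucc]
          simpa using hsum
        · intro w hw
          simp only [Finset.mem_filter] at hw
          rw [← hw.2, Fin.snoc_init_self]
        · intro w _
          exact Fin.init_snoc _ _
      · intro w hw
        have h1 := (Finset.mem_filter.1 (Finset.mem_filter.1 hw).1).1
        exact Fintype.mem_piFinset.1 h1 _
    · rw [walkWeight_of_not, Finset.card_eq_zero.2, Nat.cast_zero]
      · refine Finset.filter_false_of_mem fun w hw hsum => hp ?_
        rw [← hsum]
        exact walks_last hw
      · rintro ⟨h1, h2⟩
        simp at h1 h2
        exact hp ⟨h1, h2⟩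

end Counting

/-! ### Symmetries of the step sets -/

section Models

/-- A step set made of small steps, among which are north-going, south-going and east-going ones. -/
structure IsAdmissible (𝒮 : Finset (ℤ × ℤ)) : Prop where
  small : ∀ s ∈ 𝒮, (-1 ≤ s.1 ∧ s.1 ≤ 1) ∧ (-1 ≤ s.2 ∧ s.2 ≤ 1)
  east : ∃ s ∈ 𝒮, s.1 = 1
  north : ∃ s ∈ 𝒮, s.2 = 1
  south : ∃ s ∈ 𝒮, s.2 = -1

/-- The symmetry of a step set under `(i, j) ↦ (-i, j + k * i)`. -/
def PhiSymm (𝒮 : Finset (ℤ × ℤ)) (k : ℤ) : Prop := ∀ s ∈ 𝒮, (-s.1, s.2 + k * s.1) ∈ 𝒮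

/-- The symmetry of a step set under `(i, j) ↦ (i + m * j, -j)`. -/
def PsiSymm (𝒮 : Finset (ℤ × ℤ)) (m : ℤ) : Prop := ∀ s ∈ 𝒮, (s.1 + m * s.2, -s.2) ∈ 𝒮

instance (𝒮 : Finset (ℤ × ℤ)) (k : ℤ) : Decidable (PhiSymm 𝒮 k) := by
  unfold PhiSymm; infer_instance

instance (𝒮 : Finset (ℤ × ℤ)) (k : ℤ) : Decidable (PsiSymm 𝒮 k) := by
  unfold PsiSymm; infer_instance

instance (𝒮 : Finset (ℤ × ℤ)) : Decidable (IsAdmissible 𝒮) :=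
  decidable_of_iff ((∀ s ∈ 𝒮, (-1 ≤ s.1 ∧ s.1 ≤ 1) ∧ (-1 ≤ s.2 ∧ s.2 ≤ 1)) ∧ (∃ s ∈ 𝒮, s.1 = 1) ∧
    (∃ s ∈ 𝒮, s.2 = 1) ∧ ∃ s ∈ 𝒮, s.2 = -1)
    ⟨fun h => ⟨h.1, h.2.1, h.2.2.1, h.2.2.2⟩, fun h => ⟨h.1, h.2, h.3, h.4⟩⟩

/-- The 16 models of order 4 have the vertical symmetry; the two remaining models of order 6 have `k
= m = 1`, and the remaining one of order 8 has `k = 1`, `m = 2`. Nothing else about the individual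
models is used later. -/
theorem models_symm :
    ∀ 𝒮 ∈ finiteGroupModels \ {kreweras, reverseKreweras, doubleKreweras, gessel},
    IsAdmissible 𝒮 ∧ (PhiSymm 𝒮 0 ∨ PhiSymm 𝒮 1 ∧ (PsiSymm 𝒮 1 ∨ PsiSymm 𝒮 2)) := by
  decide +kernel

end Models

/-! ### The quotients `A₋₁/A₁` and `B₋₁/B₁` -/

section Coefficients

variable {𝒮 : Finset (ℤ × ℤ)}

theorem ratFuncToLaurent_X_zpow {F : Type*} [Field F] (n : ℤ) :
    ratFuncToLaurent F (RatFunc.X ^ n) = HahnSeries.single n 1 := by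
  rw [map_zpow₀, ratFuncToLaurent_X]
  have h : ∀ n : ℕ, (HahnSeries.single 1 1 : LaurentSeries F) ^ n = HahnSeries.single (n : ℤ) 1 :=
    fun n => by rw [HahnSeries.single_pow, one_pow, nsmul_one]
  rcases n.eq_nat_or_neg with ⟨n, rfl | rfl⟩
  · rw [zpow_natCast, h]
  · rw [zpow_neg, zpow_natCast, h, HahnSeries.inv_single, inv_one]

/-- The coefficient at an exponent that occurs is its multiplicity, nonzero in characteristic 0. -/
theorem sum_X_zpow_ne_zero {F ι : Type*} [Field F] [CharZero F] {I : Finset ι} (e : ι → ℤ)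
    (hI : I.Nonempty) : ∑ i ∈ I, (RatFunc.X : RatFunc F) ^ e i ≠ 0 := by
  classical
  obtain ⟨i, hi⟩ := hI
  intro h
  have h1 := congrArg (fun f => (ratFuncToLaurent F f).coeff (e i)) h
  simp only [map_sum, ratFuncToLaurent_X_zpow, map_zero, HahnSeries.coeff_zero,
    HahnSeries.coeff_sum] at h1
  simp only [HahnSeries.coeff_single] at h1
  have h2 : ((I.filter fun j => e i = e j).card : F) = 0 := by
    rw [← h1, Finset.card_filter, Nat.cast_sum]
    exact Finset.sum_congr rfl fun j _ => by split_ifs <;> simp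
  rw [Nat.cast_eq_zero, Finset.card_eq_zero] at h2
  exact Finset.notMem_empty i (h2 ▸ Finset.mem_filter.2 ⟨hi, rfl⟩)

/-- The coefficient `A_k(x)` as an element of `ℚ(x)`. -/
def coeffA (𝒮 : Finset (ℤ × ℤ)) (k : ℤ) : Qx := ∑ s ∈ 𝒮 with s.2 = k, RatFunc.X ^ s.1

/-- The quotient `A₋₁(x) / A₁(x)`. -/
def ratioA (𝒮 : Finset (ℤ × ℤ)) : Qx := coeffA 𝒮 (-1) / coeffA 𝒮 1

theorem A_eq (k : ℤ) : A 𝒮 k = RatFunc.C (coeffA 𝒮 k) := by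
  simp [A, coeffA, x]

theorem A_div_A : A 𝒮 (-1) / A 𝒮 1 = RatFunc.C (ratioA 𝒮) := by
  rw [A_eq, A_eq, ratioA, map_div₀]

theorem coeffA_ne_zero {k : ℤ} (h : ∃ s ∈ 𝒮, s.2 = k) : coeffA 𝒮 k ≠ 0 := by
  obtain ⟨s, hs, hk⟩ := h
  exact sum_X_zpow_ne_zero _ ⟨s, Finset.mem_filter.2 ⟨hs, hk⟩⟩

theorem B_ne_zero {k : ℤ} (h : ∃ s ∈ 𝒮, s.1 = k) : B 𝒮 k ≠ 0 := by
  obtain ⟨s, hs, hk⟩ := h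
  exact sum_X_zpow_ne_zero _ ⟨s, Finset.mem_filter.2 ⟨hs, hk⟩⟩

theorem ratioA_ne_zero (h : IsAdmissible 𝒮) : ratioA 𝒮 ≠ 0 :=
  div_ne_zero (coeffA_ne_zero h.south) (coeffA_ne_zero h.north)

theorem ratioA_mul_coeffA (h : IsAdmissible 𝒮) : ratioA 𝒮 * coeffA 𝒮 1 = coeffA 𝒮 (-1) :=
  div_mul_cancel₀ _ (coeffA_ne_zero h.north)

theorem ratioA_eq (h : IsAdmissible 𝒮) {m : ℤ} (hm : PsiSymm 𝒮 m) :
    ratioA 𝒮 = RatFunc.X ^ m := by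
  rw [ratioA, div_eq_iff (coeffA_ne_zero h.north), coeffA, coeffA, Finset.mul_sum]
  refine Finset.sum_bij' (fun s _ => (s.1 + m * s.2, -s.2)) (fun s _ => (s.1 + m * s.2, -s.2))
    ?_ ?_ ?_ ?_ ?_
  · intro s hs
    rw [Finset.mem_filter] at hs ⊢
    exact ⟨hm s hs.1, by simp [hs.2]⟩
  · intro s hs
    rw [Finset.mem_filter] at hs ⊢
    exact ⟨hm s hs.1, by simp [hs.2]⟩
  · intro s _; ext <;> simp
  · intro s _; ext <;> simp
  · intro s hs
    rw [← zpow_add₀ RatFunc.X_ne_zero, (Finset.mem_filter.1 hs).2]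
    congr 1
    ring

theorem B_div_B (h : IsAdmissible 𝒮) {k : ℤ} (hk : PhiSymm 𝒮 k) : B 𝒮 (-1) / B 𝒮 1 = y ^ k := by
  rw [div_eq_iff (B_ne_zero h.east), B, B, Finset.mul_sum]
  refine Finset.sum_bij' (fun s _ => (-s.1, s.2 + k * s.1)) (fun s _ => (-s.1, s.2 + k * s.1))
    ?_ ?_ ?_ ?_ ?_
  · intro s hs
    rw [Finset.mem_filter] at hs ⊢
    exact ⟨hk s hs.1, by simp [hs.2]⟩
  · intro s hs
    rw [Finset.mem_filter] at hs ⊢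
    exact ⟨hk s hs.1, by simp [hs.2]⟩
  · intro s _; ext <;> simp
  · intro s _; ext <;> simp
  · intro s hs
    rw [← zpow_add₀ (show y ≠ 0 from RatFunc.X_ne_zero), (Finset.mem_filter.1 hs).2]
    congr 1
    ring

end Coefficients

/-! ### The involutions `Φ` and `Ψ` -/

section Group

variable {𝒮 : Finset (ℤ × ℤ)}

theorem x_ne_zero : x ≠ 0 := (map_ne_zero _).2 RatFunc.X_ne_zero

theorem y_ne_zero : y ≠ 0 := RatFunc.X_ne_zero

theorem X_pow_ne_C {F : Type*} [Field F] {n : ℕ} (hn : n ≠ 0) (a : F) :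
    (RatFunc.X : RatFunc F) ^ n ≠ RatFunc.C a := by
  intro h
  rw [← RatFunc.algebraMap_X, ← map_pow, ← RatFunc.algebraMap_C] at h
  have := congrArg Polynomial.natDegree (RatFunc.algebraMap_injective F h)
  simp at this
  exact hn this

theorem map_C_of_map_x {g : RingAut Qxy} (hg : g x = x) (a : Qx) :
    g (RatFunc.C a) = RatFunc.C a := by
  have h : (RingHom.eqLocusField (g : Qxy →+* Qxy) (RingHom.id Qxy)).comap
      (RatFunc.C : Qx →+* Qxy) = ⊤ := by
    refine ratFunc_induction_subfield _ (fun r => ?_) hg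
    change g (RatFunc.C (RatFunc.C r)) = RatFunc.C (RatFunc.C r)
    rw [show RatFunc.C (RatFunc.C r) = (r : Qxy) by
      rw [eq_ratCast (RatFunc.C : ℚ →+* Qx), map_ratCast], map_ratCast]
  have : a ∈ (RingHom.eqLocusField (g : Qxy →+* Qxy) (RingHom.id Qxy)).comap
      (RatFunc.C : Qx →+* Qxy) := h ▸ Subfield.mem_top a
  exact this

theorem C_mem_closure {b : Qxy} (a : Qx) : RatFunc.C a ∈ Subfield.closure {x, b} := by
  have h : (Subfield.closure {x, b}).comap (RatFunc.C : Qx →+* Qxy) = ⊤ := by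
    refine ratFunc_induction_subfield _ (fun r => ?_) (Subfield.subset_closure (by simp [x]))
    rw [Subfield.mem_comap, show RatFunc.C (RatFunc.C r) = (r : Qxy) by
      rw [eq_ratCast (RatFunc.C : ℚ →+* Qx), map_ratCast]]
    exact SubfieldClass.ratCast_mem _ r
  have : a ∈ (Subfield.closure {x, b}).comap (RatFunc.C : Qx →+* Qxy) := h ▸ Subfield.mem_top a
  exact this

/-- The automorphisms `Φ` and `Ψ`, when `B₋₁ / B₁ = y ^ k`. -/
theorem exists_generators (h : IsAdmissible 𝒮) {k : ℕ} (hk : PhiSymm 𝒮 k) (hk1 : k ≤ 1) :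
    ∃ a b : RingAut Qxy, generators 𝒮 = {a, b} ∧ a x = x⁻¹ * y ^ k ∧ a y = y ∧ b x = x ∧
      b y = y⁻¹ * RatFunc.C (ratioA 𝒮) ∧ a * a = 1 ∧ b * b = 1 ∧ a ≠ 1 ∧ b ≠ 1 := by
  have hx := x_ne_zero
  have hy := y_ne_zero
  have hr : (RatFunc.C (ratioA 𝒮) : Qxy) ≠ 0 := (map_ne_zero _).2 (ratioA_ne_zero h)
  obtain ⟨a, hax, hay⟩ := exists_ringAut (a := x⁻¹ * y ^ k) (b := y) (by
      have h1 : x⁻¹ * y ^ k ∈ Subfield.closure {x⁻¹ * y ^ k, y} :=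
        Subfield.subset_closure (by simp)
      have h2 : y ∈ Subfield.closure {x⁻¹ * y ^ k, y} := Subfield.subset_closure (by simp)
      have h3 := mul_mem (inv_mem h1) (pow_mem h2 k)
      rwa [mul_inv, inv_inv, mul_assoc, inv_mul_cancel₀ (pow_ne_zero _ hy), mul_one] at h3)
    (Subfield.subset_closure (by simp))
  obtain ⟨b, hbx, hby⟩ := exists_ringAut (a := x) (b := y⁻¹ * RatFunc.C (ratioA 𝒮))
    (Subfield.subset_closure (by simp)) (by
      have h1 : y⁻¹ * RatFunc.C (ratioA 𝒮) ∈
        Subfield.closure {x, y⁻¹ * RatFunc.C (ratioA 𝒮)} := Subfield.subset_closure (by simp)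
      have h3 := mul_mem (inv_mem h1) (C_mem_closure (ratioA 𝒮))
      rwa [mul_inv, inv_inv, mul_assoc, inv_mul_cancel₀ hr, mul_one] at h3)
  have hB : B 𝒮 (-1) / B 𝒮 1 = y ^ k := by rw [B_div_B h hk, zpow_natCast]
  refine ⟨a, b, ?_, hax, hay, hbx, hby, ringAut_ext ?_ ?_, ringAut_ext ?_ ?_, ?_, ?_⟩
  · ext g
    change (IsPhi 𝒮 g ∨ IsPsi 𝒮 g) ↔ (g = a ∨ g = b)
    refine or_congr ?_ ?_
    · rw [IsPhi, hB]
      exact ⟨fun hg => ringAut_ext (hg.1.trans hax.symm) (hg.2.trans hay.symm),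
        by rintro rfl; exact ⟨hax, hay⟩⟩
    · rw [IsPsi, A_div_A]
      exact ⟨fun hg => ringAut_ext (hg.1.trans hbx.symm) (hg.2.trans hby.symm),
        by rintro rfl; exact ⟨hbx, hby⟩⟩
  · rw [RingAut.mul_apply, hax, map_mul, map_inv₀, map_pow, hax, hay, RingAut.one_apply]
    field_simp
  · rw [RingAut.mul_apply, hay, hay, RingAut.one_apply]
  · rw [RingAut.mul_apply, hbx, hbx, RingAut.one_apply]
  · rw [RingAut.mul_apply, hby, map_mul, map_inv₀, map_C_of_map_x hbx, hby, RingAut.one_apply]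
    field_simp
  · rintro rfl
    rw [RingAut.one_apply] at hax
    -- A trivial `Φ` would give `y^k = x²`: for `k = 0` the variable `x` would be algebraic, for `k
    -- = 1` `y` would lie in `ℚ(x)`.
    have h1 : y ^ k = (RatFunc.C (RatFunc.X ^ 2) : Qxy) := by
      rw [map_pow]
      change y ^ k = x ^ 2
      nth_rewrite 1 [pow_two, hax]
      field_simp
    interval_cases k
    · rw [pow_zero, ← map_one RatFunc.C] at h1
      exact X_pow_ne_C (F := ℚ) (n := 2) (by simp) 1
        ((map_one RatFunc.C).trans ((RatFunc.C : Qx →+* Qxy).injective h1)).symm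
    · exact X_pow_ne_C one_ne_zero _ h1
  · rintro rfl
    rw [RingAut.one_apply] at hby
    refine X_pow_ne_C (n := 2) (by simp) (ratioA 𝒮) ?_
    change y ^ 2 = _
    nth_rewrite 1 [pow_two, hby]
    field_simp

theorem orbitSum_eq {a b : RingAut Qxy} (hgen : generators 𝒮 = {a, b}) (ha : a * a = 1)
    (hb : b * b = 1) (ha1 : a ≠ 1) (hb1 : b ≠ 1) {m : ℕ} (hm : 0 < m)
    (hord : orderOf (a * b) = m) :
    orbitSum 𝒮 = ∑ i ∈ Finset.range m, (((a * b) ^ i) (x * y) - ((a * b) ^ i) (a (x * y))) := by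
  have h := finsum_wordSign ha hb ha1 hb1 hm hord (fun g : RingAut Qxy => g (x * y))
  rw [← hgen] at h
  exact h

theorem group_finite {a b : RingAut Qxy} (hgen : generators 𝒮 = {a, b}) (ha : a * a = 1)
    (hb : b * b = 1) {m : ℕ} (hm : 0 < m) (hord : orderOf (a * b) = m) : Finite (group 𝒮) := by
  rw [group, hgen]
  exact finite_closure_of_involutions ha hb hm hord

end Group

/-! ### Orders of the groups and explicit orbit sums -/

section OrbitSums

variable {𝒮 : Finset (ℤ × ℤ)}

theorem inv_x_ne_x : x⁻¹ ≠ x := by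
  intro h
  have h1 : x ^ 2 = 1 := by
    nth_rewrite 1 [pow_two, ← h]
    exact inv_mul_cancel₀ x_ne_zero
  rw [x, ← map_pow, ← map_one RatFunc.C] at h1
  exact X_pow_ne_C (F := ℚ) (n := 2) (by simp) 1
    (((RatFunc.C : Qx →+* Qxy).injective h1).trans (map_one RatFunc.C).symm)

theorem inv_x_mul_y_ne_x : x⁻¹ * y ≠ x := by
  intro h
  have h1 : y = x ^ 2 := by
    nth_rewrite 1 [pow_two, ← h]
    field_simp [x_ne_zero]
  rw [x, ← map_pow] at h1
  exact X_pow_ne_C one_ne_zero _ ((pow_one _).trans h1)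

/-- Here `Φ` is `x ↦ x⁻¹`, and it fixes `α = A₋₁/A₁` because the vertical symmetry fixes each `A_k`.
So `Φ` and `Ψ` commute and the sum factors, although `α` need not be a monomial. -/
theorem exists_orbitSum_four (h : IsAdmissible 𝒮) (hk : PhiSymm 𝒮 0) : Finite (group 𝒮) ∧
    orbitSum 𝒮 = (x - x⁻¹) * (y - RatFunc.C (ratioA 𝒮) * y⁻¹) := by
  obtain ⟨a, b, hgen, hax, hay, hbx, hby, ha, hb, ha1, hb1⟩ :=
    exists_generators h (k := 0) hk zero_le_one
  rw [pow_zero, mul_one] at hax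
  have hx := x_ne_zero
  have hy := y_ne_zero
  have haA : ∀ k, a (A 𝒮 k) = A 𝒮 k := fun k => by
    simp only [A, map_sum, map_zpow₀, hax]
    refine Finset.sum_bij' (fun s _ => (-s.1, s.2)) (fun s _ => (-s.1, s.2)) ?_ ?_ ?_ ?_ ?_
    · intro s hs
      rw [Finset.mem_filter] at hs ⊢
      exact ⟨by simpa using hk s hs.1, hs.2⟩
    · intro s hs
      rw [Finset.mem_filter] at hs ⊢
      exact ⟨by simpa using hk s hs.1, hs.2⟩
    · intro s _; ext <;> simp
    · intro s _; ext <;> simp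
    · intro s _; simp
  have hac : a (RatFunc.C (ratioA 𝒮)) = RatFunc.C (ratioA 𝒮) := by
    rw [← A_div_A, map_div₀, haA, haA]
  generalize (RatFunc.C (ratioA 𝒮) : Qxy) = α at *
  have hcx : (a * b) x = x⁻¹ := by rw [RingAut.mul_apply, hbx, hax]
  have hcy : (a * b) y = y⁻¹ * α := by
    rw [RingAut.mul_apply, hby, map_mul, map_inv₀, hay, hac]
  have hcα : (a * b) α = α := by
    -- `α = y * Ψ(y)`, and the involution `Ψ` swaps the factors.
    have : b α = α := by
      have h1 : α = y * b y := by rw [hby, mul_inv_cancel_left₀ hy]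
      have h2 := congrArg (fun g : RingAut Qxy => g y) hb
      simp only [RingAut.mul_apply, RingAut.one_apply] at h2
      conv_lhs => rw [h1, map_mul, h2]
      rw [hby]
      field_simp
    rw [RingAut.mul_apply, this, hac]
  have hα : α ≠ 0 := by
    rintro rfl
    rw [mul_zero] at hcy
    exact hy ((map_eq_zero _).1 hcy)
  have hord : orderOf (a * b) = 2 := by
    refine orderOf_eq_prime (ringAut_ext ?_ ?_) fun h1 => ?_
    · simp only [pow_two, RingAut.mul_apply (a * b), hcx, map_inv₀, inv_inv, RingAut.one_apply]
    · simp only [pow_two, RingAut.mul_apply (a * b), hcy, hcα, map_mul, map_inv₀, inv_inv,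
        mul_inv, RingAut.one_apply]
      field_simp
    · rw [h1] at hcx
      exact inv_x_ne_x hcx.symm
  refine ⟨group_finite hgen ha hb (by simp) hord, ?_⟩
  rw [orbitSum_eq hgen ha hb ha1 hb1 (by simp) hord]
  simp only [Finset.sum_range_succ, Finset.sum_range_zero, zero_add, pow_zero, pow_one, map_mul,
    RingAut.one_apply, hax, hay, hcx, hcy, map_inv₀, inv_inv]
  field_simp
  ring

/-- Both involutions are monomial substitutions; their product `(x, y) ↦ (x⁻¹y, x⁻¹)` has order 3.
-/
theorem exists_orbitSum_six (h : IsAdmissible 𝒮) (hk : PhiSymm 𝒮 1) (hm : PsiSymm 𝒮 1) :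
    Finite (group 𝒮) ∧ orbitSum 𝒮 = x * y - x⁻¹ * y ^ 2 + x⁻¹ ^ 2 * y - x⁻¹ * y⁻¹ +
      x * y⁻¹ ^ 2 - x ^ 2 * y⁻¹ := by
  obtain ⟨a, b, hgen, hax, hay, hbx, hby, ha, hb, ha1, hb1⟩ :=
    exists_generators h (k := 1) hk le_rfl
  rw [ratioA_eq h hm, zpow_one] at hby
  change b y = y⁻¹ * x at hby
  rw [pow_one] at hax
  have hx := x_ne_zero
  have hy := y_ne_zero
  have hcx : (a * b) x = x⁻¹ * y := by rw [RingAut.mul_apply, hbx, hax]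
  have hcy : (a * b) y = x⁻¹ := by
    rw [RingAut.mul_apply, hby, map_mul, map_inv₀, hay, hax]
    field_simp
  have hord : orderOf (a * b) = 3 := by
    refine orderOf_eq_prime (ringAut_ext ?_ ?_) fun h1 => ?_
    · simp only [pow_succ, pow_zero, one_mul, RingAut.mul_apply (a * b),
        RingAut.mul_apply (a * b * (a * b)), hcx, hcy, map_mul, map_inv₀,
        RingAut.one_apply]
      field_simp
    · simp only [pow_succ, pow_zero, one_mul, RingAut.mul_apply (a * b),
        RingAut.mul_apply (a * b * (a * b)), hcx, hcy, map_mul, map_inv₀,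
        RingAut.one_apply]
      field_simp
    · rw [h1] at hcx
      exact inv_x_mul_y_ne_x hcx.symm
  refine ⟨group_finite hgen ha hb (by simp) hord, ?_⟩
  rw [orbitSum_eq hgen ha hb ha1 hb1 (by simp) hord]
  simp only [Finset.sum_range_succ, Finset.sum_range_zero, zero_add, pow_succ, pow_zero, one_mul,
    map_mul, RingAut.one_apply, hax, hay, RingAut.mul_apply (a * b), hcx, hcy, map_inv₀, inv_inv,
    mul_inv]
  field_simp
  ring

/-- Again monomial; the square of the product is `(x, y) ↦ (x⁻¹, y⁻¹)`, so the order is 4. -/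
theorem exists_orbitSum_eight (h : IsAdmissible 𝒮) (hk : PhiSymm 𝒮 1) (hm : PsiSymm 𝒮 2) :
    Finite (group 𝒮) ∧ orbitSum 𝒮 = x * y - x⁻¹ * y ^ 2 + x⁻¹ ^ 3 * y ^ 2 - x⁻¹ ^ 3 * y +
      x⁻¹ * y⁻¹ - x * y⁻¹ ^ 2 + x ^ 3 * y⁻¹ ^ 2 - x ^ 3 * y⁻¹ := by
  obtain ⟨a, b, hgen, hax, hay, hbx, hby, ha, hb, ha1, hb1⟩ :=
    exists_generators h (k := 1) hk le_rfl
  rw [ratioA_eq h hm, map_zpow₀] at hby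
  change b y = y⁻¹ * x ^ (2 : ℤ) at hby
  rw [pow_one] at hax
  rw [zpow_ofNat] at hby
  have hx := x_ne_zero
  have hy := y_ne_zero
  have hcx : (a * b) x = x⁻¹ * y := by rw [RingAut.mul_apply, hbx, hax]
  have hcy : (a * b) y = x⁻¹ * x⁻¹ * y := by
    rw [RingAut.mul_apply, hby, map_mul, map_inv₀, hay, map_pow, hax]
    field_simp
  have hcx2 : ((a * b) ^ 2) x = x⁻¹ := by
    simp only [pow_two, RingAut.mul_apply (a * b), hcx, hcy, map_mul, map_inv₀, mul_inv, inv_inv]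
    field_simp
  have hcy2 : ((a * b) ^ 2) y = y⁻¹ := by
    simp only [pow_two, RingAut.mul_apply (a * b), hcx, hcy, map_mul, map_inv₀, mul_inv, inv_inv]
    field_simp
  have hord : orderOf (a * b) = 4 := by
    refine orderOf_eq_prime_pow (p := 2) (n := 1) (fun h1 => ?_) (ringAut_ext ?_ ?_)
    · rw [pow_one] at h1
      rw [h1] at hcx2
      exact inv_x_ne_x hcx2.symm
    · rw [pow_succ, pow_one, pow_mul, pow_two, RingAut.mul_apply ((a * b) ^ 2), hcx2, map_inv₀,
        hcx2, inv_inv, RingAut.one_apply]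
    · rw [pow_succ, pow_one, pow_mul, pow_two, RingAut.mul_apply ((a * b) ^ 2), hcy2, map_inv₀,
        hcy2, inv_inv, RingAut.one_apply]
  refine ⟨group_finite hgen ha hb (by simp) hord, ?_⟩
  rw [orbitSum_eq hgen ha hb ha1 hb1 (by simp) hord]
  have h3 : ∀ f, ((a * b) ^ 3) f = ((a * b) ^ 2) ((a * b) f) := fun f => by
    rw [pow_succ, RingAut.mul_apply]
  simp only [Finset.sum_range_succ, Finset.sum_range_zero, zero_add, pow_zero, pow_one,
    map_mul, RingAut.one_apply, hax, hay, h3, hcx, hcy, hcx2, hcy2, map_inv₀, inv_inv,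
    mul_inv]
  field_simp
  ring

end OrbitSums

/-! ### Reflection in the horizontal axis, with coefficients in `ℚ(x)` -/

section LaurentPolynomials

theorem laurentXToQx_single (k : ℤ) (a : ℚ) :
    laurentXToQx (AddMonoidAlgebra.single k a) = RatFunc.C a * RatFunc.X ^ k := by
  rw [LaurentPolynomial.single_eq_C_mul_T, laurentXToQx, LaurentPolynomial.eval₂_C_mul_T,
    Units.val_zpow_eq_zpow_val, Units.val_mk0]

theorem laurentYToQxy_single (k : ℤ) (a : Qx) :
    laurentYToQxy (AddMonoidAlgebra.single k a) = RatFunc.C a * y ^ k := by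
  rw [LaurentPolynomial.single_eq_C_mul_T, laurentYToQxy, LaurentPolynomial.eval₂_C_mul_T,
    Units.val_zpow_eq_zpow_val, Units.val_mk0]
  rfl

/-- The step polynomial as a Laurent polynomial in `y`. -/
def stepLaurent (𝒮 : Finset (ℤ × ℤ)) : LaurentY :=
  ∑ s ∈ 𝒮, AddMonoidAlgebra.single s.2 (RatFunc.X ^ s.1)

theorem laurentYToQxy_stepLaurent (𝒮 : Finset (ℤ × ℤ)) :
    laurentYToQxy (stepLaurent 𝒮) = stepPoly 𝒮 := by
  simp only [stepLaurent, map_sum, laurentYToQxy_single, map_zpow₀, stepPoly, x]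

/-- The part of a sum of monomials with exponents in `P`, minus those with exponents in `M`, which
is antisymmetric under `y ↦ α / y`. -/
def antisymLaurent (P M : Finset (ℤ × ℤ)) (α : Qx) : LaurentY :=
  ∑ p ∈ P, (AddMonoidAlgebra.single p.2 (RatFunc.X ^ p.1) -
    AddMonoidAlgebra.single (-p.2) (RatFunc.X ^ p.1 * α ^ p.2)) -
  ∑ p ∈ M, (AddMonoidAlgebra.single p.2 (RatFunc.X ^ p.1) -
    AddMonoidAlgebra.single (-p.2) (RatFunc.X ^ p.1 * α ^ p.2))

theorem laurentYToQxy_antisymLaurent (P M : Finset (ℤ × ℤ)) (α : Qx) :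
    laurentYToQxy (antisymLaurent P M α) =
      ∑ p ∈ P, (x ^ p.1 * y ^ p.2 - x ^ p.1 * RatFunc.C α ^ p.2 * y ^ (-p.2)) -
      ∑ p ∈ M, (x ^ p.1 * y ^ p.2 - x ^ p.1 * RatFunc.C α ^ p.2 * y ^ (-p.2)) := by
  simp only [antisymLaurent, map_sub, map_sum, laurentYToQxy_single, map_mul, map_zpow₀, x]

theorem coeff_antisymLaurent_neg (P M : Finset (ℤ × ℤ)) {α : Qx} (hα : α ≠ 0) (j : ℤ) :
    (antisymLaurent P M α).coeff (-j) = -(α ^ j * (antisymLaurent P M α).coeff j) := by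
  have h : ∀ p : ℤ × ℤ, ((AddMonoidAlgebra.single p.2 (RatFunc.X ^ p.1) -
      AddMonoidAlgebra.single (-p.2) (RatFunc.X ^ p.1 * α ^ p.2) : LaurentY)).coeff (-j) =
      -(α ^ j * ((AddMonoidAlgebra.single p.2 (RatFunc.X ^ p.1) -
      AddMonoidAlgebra.single (-p.2) (RatFunc.X ^ p.1 * α ^ p.2) : LaurentY)).coeff j) := by
    intro p
    simp only [AddMonoidAlgebra.coeff_sub, AddMonoidAlgebra.coeff_single, Finsupp.sub_apply,
      Finsupp.single_apply, neg_inj]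
    by_cases h1 : p.2 = j
    · by_cases h2 : p.2 = -j
      · have : j = 0 := by omega
        subst this
        simp [h1]
      · rw [if_neg h2, if_pos h1, if_pos h1, if_neg (by omega), h1]
        ring
    · by_cases h2 : p.2 = -j
      · rw [if_pos h2, if_neg h1, if_neg h1, if_pos (by omega), h2, zpow_neg]
        field_simp
        ring
      · rw [if_neg h2, if_neg h1, if_neg h1, if_neg (by omega)]
        ring
  simp only [antisymLaurent] at *
  rw [AddMonoidAlgebra.coeff_sub, AddMonoidAlgebra.coeff_sum, AddMonoidAlgebra.coeff_sum,
    Finsupp.sub_apply, Finsupp.sub_apply, Finsupp.finsetSum_apply, Finsupp.finsetSum_apply,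
    Finsupp.finsetSum_apply, Finsupp.finsetSum_apply, Finset.sum_congr rfl fun p _ => h p,
    Finset.sum_congr (s₁ := M) rfl fun p _ => h p, Finset.sum_neg_distrib, Finset.sum_neg_distrib,
    ← Finset.mul_sum, ← Finset.mul_sum]
  ring

variable {𝒮 P M : Finset (ℤ × ℤ)}

theorem coeff_mul_stepLaurent (f : LaurentY) (j : ℤ) :
    (f * stepLaurent 𝒮).coeff j = ∑ s ∈ 𝒮, RatFunc.X ^ s.1 * f.coeff (j - s.2) := by
  simp only [stepLaurent, Finset.mul_sum, AddMonoidAlgebra.coeff_sum, Finsupp.finsetSum_apply,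
    AddMonoidAlgebra.coeff_mul_single_apply, ← sub_eq_add_neg, mul_comm]

theorem sum_steps_eq (h : IsAdmissible 𝒮) (g : ℤ → Qx) :
    ∑ s ∈ 𝒮, RatFunc.X ^ s.1 * g s.2 =
      coeffA 𝒮 1 * g 1 + coeffA 𝒮 0 * g 0 + coeffA 𝒮 (-1) * g (-1) := by
  rw [← Finset.sum_fiberwise_of_maps_to (t := {1, 0, -1}) (g := fun s : ℤ × ℤ => s.2)]
  · rw [Finset.sum_insert (by decide), Finset.sum_insert (by decide), Finset.sum_singleton,
      ← add_assoc]
    simp only [coeffA, Finset.sum_mul]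
    congr 1
    · congr 1 <;> exact Finset.sum_congr rfl fun s hs => by rw [(Finset.mem_filter.1 hs).2]
    · exact Finset.sum_congr rfl fun s hs => by rw [(Finset.mem_filter.1 hs).2]
  · intro s hs
    have := (h.small s hs).2
    simp only [Finset.mem_insert, Finset.mem_singleton]
    omega

/-- Antisymmetry under `y ↦ α/y`, read on coefficients. It survives multiplication by the step
polynomial because `α A₁ = A₋₁`, which is the invariance of the latter. As `α` is only a rational
function of `x`, this reflection cannot be done on the walks themselves. -/
theorem coeff_mul_stepLaurent_pow_neg (h : IsAdmissible 𝒮) (n : ℕ) (j : ℤ) :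
    (antisymLaurent P M (ratioA 𝒮) * stepLaurent 𝒮 ^ n).coeff (-j) =
      -(ratioA 𝒮 ^ j * (antisymLaurent P M (ratioA 𝒮) * stepLaurent 𝒮 ^ n).coeff j) := by
  have hα := ratioA_ne_zero h
  induction n generalizing j with
  | zero => rw [pow_zero, mul_one, coeff_antisymLaurent_neg _ _ hα]
  | succ n ih =>
    rw [pow_succ, ← mul_assoc, coeff_mul_stepLaurent, coeff_mul_stepLaurent]
    generalize antisymLaurent P M (ratioA 𝒮) * stepLaurent 𝒮 ^ n = f at *
    rw [sum_steps_eq h fun k => f.coeff (-j - k), sum_steps_eq h fun k => f.coeff (j - k),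
      show -j - 1 = -(j + 1) by ring, show -j - 0 = -j by ring, show -j - -1 = -(j - 1) by ring,
      show j - 0 = j by ring, show j - -1 = j + 1 by ring, ih, ih, ih, ← ratioA_mul_coeffA h,
      zpow_add_one₀ hα, zpow_sub_one₀ hα]
    field_simp
    ring

theorem coeff_mul_stepLaurent_pow_zero (h : IsAdmissible 𝒮) (n : ℕ) :
    (antisymLaurent P M (ratioA 𝒮) * stepLaurent 𝒮 ^ n).coeff 0 = 0 := by
  have := coeff_mul_stepLaurent_pow_neg (P := P) (M := M) h n 0
  rw [neg_zero, zpow_zero, one_mul] at this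
  exact self_eq_neg.1 this

/-- The generating polynomials of the walks in the upper half-plane that end at height `j`, where
the walks start with weight `1` in `P` and with weight `-1` in `M`. -/
def halfPlanePoly (𝒮 P M : Finset (ℤ × ℤ)) : ℕ → ℤ → LaurentX
  | 0, j => if 1 ≤ j then ∑ p ∈ P with p.2 = j, AddMonoidAlgebra.single p.1 1 -
      ∑ p ∈ M with p.2 = j, AddMonoidAlgebra.single p.1 1 else 0
  | n + 1, j => if 1 ≤ j then
      ∑ s ∈ 𝒮, AddMonoidAlgebra.single s.1 1 * halfPlanePoly 𝒮 P M n (j - s.2) else 0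

theorem halfPlanePoly_of_not (n : ℕ) {j : ℤ} (hj : ¬ 1 ≤ j) : halfPlanePoly 𝒮 P M n j = 0 := by
  cases n <;> rw [halfPlanePoly, if_neg hj]

/-- The weight `1` on `P` and `-1` on `M`. -/
def signedIndicator (P M : Finset (ℤ × ℤ)) (p : ℤ × ℤ) : ℚ :=
  (if p ∈ P then 1 else 0) - (if p ∈ M then 1 else 0)

theorem coeff_halfPlanePoly (n : ℕ) (i j : ℤ) : (halfPlanePoly 𝒮 P M n j).coeff i =
    walkWeight 𝒮 (fun p => 1 ≤ p.2) (signedIndicator P M) n (i, j) := by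
  induction n generalizing i j with
  | zero =>
    by_cases hj : 1 ≤ j
    · have h : ∀ U : Finset (ℤ × ℤ), (∑ p ∈ U with p.2 = j,
          (AddMonoidAlgebra.single p.1 1 : LaurentX)).coeff i = if (i, j) ∈ U then 1 else 0 := by
        intro U
        rw [AddMonoidAlgebra.coeff_sum, Finsupp.finsetSum_apply]
        simp only [AddMonoidAlgebra.coeff_single, Finsupp.single_apply, Finset.sum_filter,
          ← ite_and]
        have h1 : ∀ p : ℤ × ℤ, (p.2 = j ∧ p.1 = i) ↔ (i, j) = p := fun p => by
          rw [Prod.ext_iff]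
          simp only
          omega
        simp only [h1, Finset.sum_ite_eq]
      rw [walkWeight_zero (D := fun p : ℤ × ℤ => 1 ≤ p.2) hj, halfPlanePoly, if_pos hj,
        AddMonoidAlgebra.coeff_sub, Finsupp.sub_apply, h, h, signedIndicator]
    · rw [walkWeight_of_not (D := fun p : ℤ × ℤ => 1 ≤ p.2) _ hj, halfPlanePoly_of_not _ hj]
      rfl
  | succ n ih =>
    by_cases hj : 1 ≤ j
    · rw [walkWeight_succ (D := fun p : ℤ × ℤ => 1 ≤ p.2) _ hj, halfPlanePoly, if_pos hj,
        AddMonoidAlgebra.coeff_sum, Finsupp.finsetSum_apply]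
      refine Finset.sum_congr rfl fun s _ => ?_
      rw [AddMonoidAlgebra.coeff_single_mul_apply, one_mul, ih, neg_add_eq_sub]
      rfl
    · rw [walkWeight_of_not (D := fun p : ℤ × ℤ => 1 ≤ p.2) _ hj, halfPlanePoly_of_not _ hj]
      rfl

/-- The coefficient of `y^0` always vanishes, so nothing enters from below and the positive
coefficients satisfy the half-plane recurrence. The terms with powers of `α` never contribute,
whence Laurent polynomials in `x`. -/
theorem coeff_mul_stepLaurent_pow (h : IsAdmissible 𝒮) (hP : ∀ p ∈ P, 1 ≤ p.2)
    (hM : ∀ p ∈ M, 1 ≤ p.2) (n : ℕ) {j : ℤ} (hj : 1 ≤ j) :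
    (antisymLaurent P M (ratioA 𝒮) * stepLaurent 𝒮 ^ n).coeff j =
      laurentXToQx (halfPlanePoly 𝒮 P M n j) := by
  induction n generalizing j with
  | zero =>
    have h1 : ∀ U : Finset (ℤ × ℤ), (∀ p ∈ U, 1 ≤ p.2) →
        (∑ p ∈ U, (AddMonoidAlgebra.single p.2 (RatFunc.X ^ p.1) -
          AddMonoidAlgebra.single (-p.2) (RatFunc.X ^ p.1 * ratioA 𝒮 ^ p.2)) : LaurentY).coeff j =
        laurentXToQx (∑ p ∈ U with p.2 = j, AddMonoidAlgebra.single p.1 1) := by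
      intro U hU
      rw [map_sum, Finset.sum_filter, AddMonoidAlgebra.coeff_sum, Finsupp.finsetSum_apply]
      refine Finset.sum_congr rfl fun p hp => ?_
      have := hU p hp
      rw [AddMonoidAlgebra.coeff_sub, Finsupp.sub_apply, AddMonoidAlgebra.coeff_single,
        AddMonoidAlgebra.coeff_single, Finsupp.single_apply, Finsupp.single_apply,
        if_neg (c := -p.2 = j) (by omega), sub_zero, laurentXToQx_single, map_one, one_mul]
    rw [pow_zero, mul_one, halfPlanePoly, if_pos hj, antisymLaurent, AddMonoidAlgebra.coeff_sub,
      Finsupp.sub_apply, h1 P hP, h1 M hM, map_sub]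
  | succ n ih =>
    rw [pow_succ, ← mul_assoc, coeff_mul_stepLaurent, halfPlanePoly, if_pos hj, map_sum]
    refine Finset.sum_congr rfl fun s hs => ?_
    rw [map_mul, laurentXToQx_single, map_one, one_mul]
    congr 1
    by_cases hjs : 1 ≤ j - s.2
    · exact ih hjs
    · have h0 : j - s.2 = 0 := by
        have := (h.small s hs).2
        omega
      rw [halfPlanePoly_of_not _ hjs, h0, coeff_mul_stepLaurent_pow_zero h, map_zero]

end LaurentPolynomials

/-! ### Reflection in the vertical axis and quadrant walks -/

section Reflection

variable {𝒮 P M : Finset (ℤ × ℤ)}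

/-- The action of `Φ` on exponents, when `B₋₁ / B₁ = y ^ k`. -/
def phiHom (k : ℤ) : ℤ × ℤ →+ ℤ × ℤ where
  toFun p := (-p.1, p.2 + k * p.1)
  map_zero' := by simp
  map_add' p p' := by ext <;> simp <;> ring

/-- The action of `Ψ` on exponents, when `A₋₁ / A₁ = x ^ m`. -/
def psiHom (m : ℤ) : ℤ × ℤ →+ ℤ × ℤ where
  toFun p := (p.1 + m * p.2, -p.2)
  map_zero' := by simp
  map_add' p p' := by ext <;> simp <;> ring

theorem phiHom_apply (k : ℤ) (p : ℤ × ℤ) : phiHom k p = (-p.1, p.2 + k * p.1) := rfl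

theorem psiHom_apply (m : ℤ) (p : ℤ × ℤ) : psiHom m p = (p.1 + m * p.2, -p.2) := rfl

theorem phiHom_phiHom (k : ℤ) (p : ℤ × ℤ) : phiHom k (phiHom k p) = p := by
  simp [phiHom_apply]

theorem psiHom_psiHom (m : ℤ) (p : ℤ × ℤ) : psiHom m (psiHom m p) = p := by
  simp [psiHom_apply]

theorem signedIndicator_antisymm {τ : ℤ × ℤ → ℤ × ℤ} (hτ : ∀ p, τ (τ p) = p)
    (hP : ∀ p ∈ P, τ p ∈ M) (hM : ∀ p ∈ M, τ p ∈ P) (p : ℤ × ℤ) :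
    signedIndicator P M (τ p) = -signedIndicator P M p := by
  have h1 : τ p ∈ P ↔ p ∈ M := ⟨fun h => hτ p ▸ hP _ h, hM p⟩
  have h2 : τ p ∈ M ↔ p ∈ P := ⟨fun h => hτ p ▸ hM _ h, hP p⟩
  simp only [signedIndicator, h1, h2, neg_sub]

/-- The walks counted with signs in the half-plane are the quarter plane walks, if the signed
weights vanish on the vertical axis. -/
theorem coeff_halfPlanePoly_eq_q (h : IsAdmissible 𝒮)
    (hP : ∀ p ∈ P, 1 ≤ p.1 → p = (1, 1)) (hP1 : (1, 1) ∈ P) (hM : ∀ p ∈ M, p.1 ≤ 0)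
    (hzero : ∀ n j, walkWeight 𝒮 (fun p => 1 ≤ p.2) (signedIndicator P M) n (0, j) = 0)
    (i j n : ℕ) : (halfPlanePoly 𝒮 P M n (j + 1)).coeff (i + 1) = q 𝒮 i j n := by
  rw [coeff_halfPlanePoly, q_eq_walkWeight]
  refine (walkWeight_restrict (fun p hp => hp.2) (fun p hp => ?_) (fun n p hp s hs hps => ?_) n
    ⟨?_, ?_⟩).symm
  · have h1 : p ∉ M := fun h1 => by have := hM p h1; omega
    have h2 : p ∈ P ↔ p = (1, 1) := ⟨fun h2 => hP p h2 hp.1, fun h2 => h2 ▸ hP1⟩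
    rw [signedIndicator, if_neg h1, sub_zero]
    simp only [h2]
  · by_cases h1 : 1 ≤ (p - s).2
    · have h2 : (p - s).1 = 0 := by
        have := (h.small s hs).1
        have h3 : ¬ 1 ≤ (p - s).1 := fun h3 => hps ⟨h3, h1⟩
        rw [Prod.fst_sub] at *
        omega
      rw [show p - s = (0, (p - s).2) from Prod.ext h2 rfl, hzero]
    · exact walkWeight_of_not _ h1
  · simp only
    omega
  · simp only
    omega

theorem walkWeight_axis_of_vertical_symm (hk : PhiSymm 𝒮 0)
    (hP : ∀ p ∈ P, phiHom 0 p ∈ M) (hM : ∀ p ∈ M, phiHom 0 p ∈ P) (n : ℕ) (j : ℤ) :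
    walkWeight 𝒮 (fun p => 1 ≤ p.2) (signedIndicator P M) n (0, j) = 0 := by
  have := walkWeight_antisymm (𝒮 := 𝒮) (D := fun p => 1 ≤ p.2) (phiHom 0) (phiHom_phiHom 0) hk
    (fun p => by simp [phiHom_apply]) (signedIndicator_antisymm (phiHom_phiHom 0) hP hM) n (0, j)
  rw [show phiHom 0 (0, j) = (0, j) by simp [phiHom_apply]] at this
  exact self_eq_neg.1 this

/-- For `k ≠ 0` the reflection `Φ` does not preserve the half-plane. The weights are therefore
extended to the whole plane: antisymmetry under `Ψ`, which fixes height 0 pointwise, shows that the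
extension restricts correctly, and antisymmetry under `Φ` makes it vanish on the axis. -/
theorem walkWeight_axis_of_symm (h : IsAdmissible 𝒮) {k m : ℤ} (hk : PhiSymm 𝒮 k)
    (hm : PsiSymm 𝒮 m) {P' M' : Finset (ℤ × ℤ)} (hP' : P = {p ∈ P' | 1 ≤ p.2})
    (hM' : M = {p ∈ M' | 1 ≤ p.2}) (hP : ∀ p ∈ P', phiHom k p ∈ M')
    (hM : ∀ p ∈ M', phiHom k p ∈ P') (hP2 : ∀ p ∈ P', psiHom m p ∈ M')
    (hM2 : ∀ p ∈ M', psiHom m p ∈ P') (n : ℕ) (j : ℤ) :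
    walkWeight 𝒮 (fun p => 1 ≤ p.2) (signedIndicator P M) n (0, j) = 0 := by
  by_cases hj : 1 ≤ j
  · rw [walkWeight_restrict (D := fun _ => True) (D' := fun p => 1 ≤ p.2)
      (z := signedIndicator P' M') (fun _ _ => trivial) (fun p hp => ?_)
      (fun n p hp s hs hps => ?_) n hj]
    · have := walkWeight_antisymm (𝒮 := 𝒮) (D := fun _ => True) (phiHom k) (phiHom_phiHom k) hk
        (fun p => Iff.rfl) (signedIndicator_antisymm (phiHom_phiHom k) hP hM) n (0, j)
      rw [show phiHom k (0, j) = (0, j) by simp [phiHom_apply]] at this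
      exact self_eq_neg.1 this
    · simp only [signedIndicator, hP', hM', Finset.mem_filter, hp, and_true]
    · have h2 : (p - s).2 = 0 := by
        have := (h.small s hs).2
        rw [Prod.snd_sub] at *
        omega
      have := walkWeight_antisymm (𝒮 := 𝒮) (D := fun _ => True) (psiHom m) (psiHom_psiHom m) hm
        (fun p => Iff.rfl) (signedIndicator_antisymm (psiHom_psiHom m) hP2 hM2) n (p - s)
      rw [show psiHom m (p - s) = p - s by ext <;> simp [psiHom_apply, h2]] at this
      exact self_eq_neg.1 this
  · exact walkWeight_of_not (D := fun p : ℤ × ℤ => 1 ≤ p.2) _ hj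

/-- The orbit sum as a Laurent polynomial in `y`, and the positive part in `y` of its products with
the powers of the step polynomial. -/
theorem exists_halfPlanePoly (h𝒮 : 𝒮 ∈ finiteGroupModels) (hK : 𝒮 ≠ kreweras)
    (hRK : 𝒮 ≠ reverseKreweras) (hDK : 𝒮 ≠ doubleKreweras) (hG : 𝒮 ≠ gessel) :
    Finite (group 𝒮) ∧ ∃ (o : LaurentY) (p : ℕ → ℤ → LaurentX), laurentYToQxy o = orbitSum 𝒮 ∧
      (∀ n j, 1 ≤ j → (o * stepLaurent 𝒮 ^ n).coeff j = laurentXToQx (p n j)) ∧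
      ∀ i j n : ℕ, (p n (j + 1)).coeff (i + 1) = q 𝒮 i j n := by
  obtain ⟨h, hsymm⟩ := models_symm 𝒮 (by simp [h𝒮, hK, hRK, hDK, hG])
  have hx := x_ne_zero
  have hy := y_ne_zero
  rcases hsymm with hk | ⟨hk, hm | hm⟩
  · obtain ⟨hfin, ho⟩ := exists_orbitSum_four h hk
    refine ⟨hfin, antisymLaurent {(1, 1)} {(-1, 1)} (ratioA 𝒮),
      halfPlanePoly 𝒮 {(1, 1)} {(-1, 1)}, ?_,
      fun n j hj => coeff_mul_stepLaurent_pow h (by decide) (by decide) n hj,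
      coeff_halfPlanePoly_eq_q h (by decide) (by decide) (by decide)
        (walkWeight_axis_of_vertical_symm hk (by decide) (by decide))⟩
    rw [laurentYToQxy_antisymLaurent, ho]
    simp only [Finset.sum_singleton, zpow_neg, zpow_one]
    ring
  · obtain ⟨hfin, ho⟩ := exists_orbitSum_six h hk hm
    -- The sets `P'` and `M'` below are the exponents of the orbit sum with sign `+` and `-`; `P`
    -- and `M` keep those with positive `y`-exponent, and antisymmetrization restores the others.
    -- The same holds for order 8.
    refine ⟨hfin, antisymLaurent {(1, 1), (-2, 1)} {(-1, 2)} (ratioA 𝒮),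
      halfPlanePoly 𝒮 {(1, 1), (-2, 1)} {(-1, 2)}, ?_,
      fun n j hj => coeff_mul_stepLaurent_pow h (by decide) (by decide) n hj,
      coeff_halfPlanePoly_eq_q h (by decide) (by decide) (by decide)
        (walkWeight_axis_of_symm h hk hm (P' := {(1, 1), (-2, 1), (1, -2)})
          (M' := {(-1, 2), (-1, -1), (2, -1)}) (by decide) (by decide) (by decide) (by decide)
          (by decide) (by decide))⟩
    have hr : RatFunc.C (ratioA 𝒮) = x := by rw [ratioA_eq h hm, zpow_one, x]
    rw [laurentYToQxy_antisymLaurent, ho, Finset.sum_pair (by decide), Finset.sum_singleton, hr]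
    change x ^ (1 : ℤ) * y ^ (1 : ℤ) - x ^ (1 : ℤ) * x ^ (1 : ℤ) * y ^ (-1 : ℤ) +
      (x ^ (-2 : ℤ) * y ^ (1 : ℤ) - x ^ (-2 : ℤ) * x ^ (1 : ℤ) * y ^ (-1 : ℤ)) -
      (x ^ (-1 : ℤ) * y ^ (2 : ℤ) - x ^ (-1 : ℤ) * x ^ (2 : ℤ) * y ^ (-2 : ℤ)) = _
    simp only [zpow_neg, zpow_ofNat]
    field_simp
    ring
  · obtain ⟨hfin, ho⟩ := exists_orbitSum_eight h hk hm
    refine ⟨hfin, antisymLaurent {(1, 1), (-3, 2)} {(-1, 2), (-3, 1)} (ratioA 𝒮),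
      halfPlanePoly 𝒮 {(1, 1), (-3, 2)} {(-1, 2), (-3, 1)}, ?_,
      fun n j hj => coeff_mul_stepLaurent_pow h (by decide) (by decide) n hj,
      coeff_halfPlanePoly_eq_q h (by decide) (by decide) (by decide)
        (walkWeight_axis_of_symm h hk hm (P' := {(1, 1), (-3, 2), (-1, -1), (3, -2)})
          (M' := {(-1, 2), (-3, 1), (1, -2), (3, -1)}) (by decide) (by decide) (by decide)
          (by decide) (by decide) (by decide))⟩
    rw [laurentYToQxy_antisymLaurent, ho, Finset.sum_pair (by decide), Finset.sum_pair (by decide),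
      ratioA_eq h hm, map_zpow₀]
    change x ^ (1 : ℤ) * y ^ (1 : ℤ) - x ^ (1 : ℤ) * (x ^ (2 : ℤ)) ^ (1 : ℤ) * y ^ (-1 : ℤ) +
      (x ^ (-3 : ℤ) * y ^ (2 : ℤ) - x ^ (-3 : ℤ) * (x ^ (2 : ℤ)) ^ (2 : ℤ) * y ^ (-2 : ℤ)) -
      (x ^ (-1 : ℤ) * y ^ (2 : ℤ) - x ^ (-1 : ℤ) * (x ^ (2 : ℤ)) ^ (2 : ℤ) * y ^ (-2 : ℤ) +
      (x ^ (-3 : ℤ) * y ^ (1 : ℤ) - x ^ (-3 : ℤ) * (x ^ (2 : ℤ)) ^ (1 : ℤ) * y ^ (-1 : ℤ))) = _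
    simp only [zpow_neg, zpow_ofNat]
    field_simp
    ring

end Reflection

/-! ### Expansions and positive parts -/

section PositiveParts

theorem coeff_ratFuncToLaurent_eval₂ {F : Type*} [Field F] (f : LaurentPolynomial F) (j : ℤ) :
    (ratFuncToLaurent F (LaurentPolynomial.eval₂ RatFunc.C
      (Units.mk0 RatFunc.X RatFunc.X_ne_zero) f)).coeff j = f.coeff j := by
  induction f using LaurentPolynomial.induction_on' with
  | add p q hp hq =>
    rw [map_add, map_add, HahnSeries.coeff_add, hp, hq, AddMonoidAlgebra.coeff_add,
      Finsupp.add_apply]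
  | C_mul_T n a =>
    rw [LaurentPolynomial.eval₂_C_mul_T, Units.val_zpow_eq_zpow_val, Units.val_mk0, map_mul,
      ratFuncToLaurent_X_zpow, ratFuncToLaurent_C, HahnSeries.C_apply,
      HahnSeries.coeff_single_zero_mul, ← LaurentPolynomial.single_eq_C_mul_T,
      AddMonoidAlgebra.coeff_single, HahnSeries.coeff_single, Finsupp.single_apply]
    simp only [eq_comm (a := n), mul_ite, mul_one, mul_zero]

theorem coeffXY_laurentYToQxy (f : LaurentY) {j : ℤ} {a : LaurentX}
    (h : f.coeff j = laurentXToQx a) (i : ℤ) : coeffXY i j (laurentYToQxy f) = a.coeff i := by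
  have h1 := coeff_ratFuncToLaurent_eval₂ f j
  change (ratFuncToLaurent ℚ ((ratFuncToLaurent Qx (laurentYToQxy f)).coeff j)).coeff i = _
  change (ratFuncToLaurent Qx (laurentYToQxy f)).coeff j = _ at h1
  rw [h1, h]
  exact coeff_ratFuncToLaurent_eval₂ a i

theorem laurentXToQx_injective : Function.Injective laurentXToQx := by
  refine (injective_iff_map_eq_zero _).2 fun a ha => LaurentPolynomial.ext fun i => ?_
  rw [← coeff_ratFuncToLaurent_eval₂ a i]
  change (ratFuncToLaurent ℚ (laurentXToQx a)).coeff i = _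
  rw [ha, map_zero]
  rfl

theorem coeff_posPart {A : Type*} [Semiring A] (f : LaurentPolynomial A) (k : ℤ) :
    (posPart f).coeff k = if 0 < k then f.coeff k else 0 := by
  rw [posPart, AddMonoidAlgebra.coeff_sum, Finsupp.finsetSum_apply]
  simp only [← LaurentPolynomial.single_eq_C_mul_T, AddMonoidAlgebra.coeff_single,
    Finsupp.single_apply, Finset.sum_filter]
  simp only [← ite_and]
  have h : ∀ j : ℤ, (0 < j ∧ j = k) ↔ k = j ∧ 0 < k := fun j => by omega
  simp only [h, ite_and, Finset.sum_ite_eq]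
  by_cases hk : f.coeff k = 0
  · simp [hk]
  · rw [if_pos (Finsupp.mem_support_iff.2 hk)]

theorem coeff_sum_monomial {A B : Type*} [Semiring A] [Semiring B] (f : Polynomial A) {g : A → B}
    (hg : g 0 = 0) (k : ℕ) :
    (f.sum fun j a => Polynomial.monomial j (g a)).coeff k = g (f.coeff k) := by
  rw [Polynomial.sum, Polynomial.finsetSum_coeff]
  simp only [Polynomial.coeff_monomial, Finset.sum_ite_eq']
  by_cases hk : f.coeff k = 0
  · rw [hk, hg, ite_self]
  · rw [if_pos (Polynomial.mem_support_iff.2 hk)]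

/-- The expansion of a rational function with denominator `1 - t * s`. -/
theorem isExpansion_geometric (o s : LaurentY) :
    IsExpansion (1 / (1 - RatFunc.X * RatFunc.C (laurentYToQxy s)) * RatFunc.C (laurentYToQxy o))
      (PowerSeries.mk fun n => o * s ^ n) := by
  set T := laurentYToQxy s
  set O := laurentYToQxy o
  have h1 : (1 - PowerSeries.X * PowerSeries.C T) * PowerSeries.mk (fun n => O * T ^ n) =
      PowerSeries.C O := by
    ext n
    rw [sub_mul, one_mul, mul_assoc, map_sub, PowerSeries.coeff_mk]
    cases n with
    | zero => simp
    | succ n =>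
      rw [PowerSeries.coeff_succ_X_mul, PowerSeries.coeff_C_mul, PowerSeries.coeff_mk,
        PowerSeries.coeff_C, if_neg (Nat.succ_ne_zero n)]
      ring
  have h2 : ratFuncToLaurent Qxy (1 - RatFunc.X * RatFunc.C T) =
      HahnSeries.ofPowerSeries ℤ Qxy (1 - PowerSeries.X * PowerSeries.C T) := by
    rw [map_sub, map_sub, map_one, map_one, map_mul, map_mul, ratFuncToLaurent_X,
      ratFuncToLaurent_C, HahnSeries.ofPowerSeries_X, HahnSeries.ofPowerSeries_C]
  have h3 : ratFuncToLaurent Qxy (1 - RatFunc.X * RatFunc.C T) ≠ 0 := by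
    rw [h2, Ne, map_eq_zero_iff _ HahnSeries.ofPowerSeries_injective]
    intro h
    have := congrArg PowerSeries.constantCoeff h
    simp at this
  have h4 : PowerSeries.map laurentYToQxy (PowerSeries.mk fun n => o * s ^ n) =
      PowerSeries.mk fun n => O * T ^ n := by
    ext n
    rw [PowerSeries.coeff_map, PowerSeries.coeff_mk, PowerSeries.coeff_mk, map_mul, map_pow]
  rw [IsExpansion, h4]
  change ratFuncToLaurent Qxy _ = HahnSeries.ofPowerSeries ℤ Qxy _
  rw [map_mul, map_div₀, map_one, ratFuncToLaurent_C, ← HahnSeries.ofPowerSeries_C, ← h1, map_mul,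
    ← h2, one_div, inv_mul_cancel_left₀ h3]

theorem q_eq_zero_of_lt {𝒮 : Finset (ℤ × ℤ)} (h : IsAdmissible 𝒮) {i j n : ℕ}
    (hn : n < i ∨ n < j) : q 𝒮 i j n = 0 := by
  refine Finset.card_eq_zero.2 (Finset.filter_false_of_mem fun w hw hsum => ?_)
  have hmem := Fintype.mem_piFinset.1 (Finset.mem_filter.1 hw).1
  have h1 : ∑ k, (w k).1 ≤ ∑ _k : Fin n, (1 : ℤ) :=
    Finset.sum_le_sum fun k _ => (h.small _ (hmem k)).1.2
  have h2 : ∑ k, (w k).2 ≤ ∑ _k : Fin n, (1 : ℤ) :=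
    Finset.sum_le_sum fun k _ => (h.small _ (hmem k)).2.2
  rw [← Prod.fst_sum, hsum] at h1
  rw [← Prod.snd_sum, hsum] at h2
  simp at h1 h2
  omega

theorem coeff_xyQ {𝒮 : Finset (ℤ × ℤ)} (h : IsAdmissible 𝒮) (n k : ℕ) (i : ℤ) :
    ((PowerSeries.coeff n (xyQ 𝒮)).coeff k).coeff i =
      if 1 ≤ i ∧ 1 ≤ k then (q 𝒮 (i - 1).toNat (k - 1) n : ℚ) else 0 := by
  have h0 : ((PowerSeries.coeff n (xyQ 𝒮)).coeff k).coeff i =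
      ∑ i' ∈ Finset.range (n + 1), ∑ j' ∈ Finset.range (n + 1),
        if 1 + j' = k ∧ 1 + (i' : ℤ) = i then (q 𝒮 i' j' n : ℚ) else 0 := by
    rw [xyQ, PowerSeries.coeff_C_mul, Qt, PowerSeries.coeff_mk, Finset.mul_sum,
      Polynomial.finsetSum_coeff, AddMonoidAlgebra.coeff_sum, Finsupp.finsetSum_apply]
    refine Finset.sum_congr rfl fun i' _ => ?_
    rw [Finset.mul_sum, Polynomial.finsetSum_coeff, AddMonoidAlgebra.coeff_sum,
      Finsupp.finsetSum_apply]
    refine Finset.sum_congr rfl fun j' _ => ?_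
    rw [Polynomial.monomial_mul_monomial, Polynomial.coeff_monomial, mul_left_comm,
      ← LaurentPolynomial.T_add, ← LaurentPolynomial.single_eq_C_mul_T, ite_and]
    split_ifs with _ h2
    · rw [AddMonoidAlgebra.coeff_single, Finsupp.single_apply, if_pos h2]
    · rw [AddMonoidAlgebra.coeff_single, Finsupp.single_apply, if_neg h2]
    · rfl
  rw [h0]
  split_ifs with hik
  · obtain ⟨a, rfl⟩ : ∃ a : ℕ, i = 1 + a := ⟨(i - 1).toNat, by omega⟩
    obtain ⟨b, rfl⟩ : ∃ b : ℕ, k = 1 + b := ⟨k - 1, by omega⟩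
    rw [show (1 + (a : ℤ) - 1).toNat = a by omega, show 1 + b - 1 = b by omega]
    have hzero : a ∉ Finset.range (n + 1) ∨ b ∉ Finset.range (n + 1) → (q 𝒮 a b n : ℚ) = 0 :=
      fun hab => by
        rw [q_eq_zero_of_lt h (by simp only [Finset.mem_range] at hab; omega), Nat.cast_zero]
    rw [Finset.sum_eq_single a, Finset.sum_eq_single b]
    · simp
    · intro j' _ hj
      rw [if_neg (by omega)]
    · intro hb
      rw [hzero (Or.inr hb), ite_self]
    · intro i' _ hi
      exact Finset.sum_eq_zero fun j' _ => if_neg (by omega)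
    · intro ha
      refine Finset.sum_eq_zero fun j' _ => ?_
      split_ifs with hj
      · rw [show j' = b by omega, hzero (Or.inl ha)]
      · rfl
  · exact Finset.sum_eq_zero fun i' _ => Finset.sum_eq_zero fun j' _ => if_neg (by omega)

/-- The successive extraction of the positive parts in `y` and in `x`. -/
theorem exists_positive_part {𝒮 : Finset (ℤ × ℤ)} (h : IsAdmissible 𝒮) {f : ℕ → LaurentY}
    {p : ℕ → ℤ → LaurentX} (hf : ∀ n j, 1 ≤ j → (f n).coeff j = laurentXToQx (p n j))
    (hp : ∀ i j n : ℕ, (p n (j + 1)).coeff (i + 1) = q 𝒮 i j n) :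
    ∃ Rplus : PowerSeries LaurentXPolyY,
      PowerSeries.map polyYToLaurentY Rplus = posPartY (PowerSeries.mk f) ∧
      xyQ 𝒮 = posPartX Rplus := by
  -- The sum is over the support of `f n` to stay finite; for positive `j` outside it, `p n j = 0`
  -- by injectivity of `laurentXToQx`.
  refine ⟨PowerSeries.mk fun n => ∑ j ∈ (f n).coeff.support with 0 < j,
    Polynomial.monomial j.toNat (p n j), ?_, ?_⟩
  · refine PowerSeries.ext fun n => ?_
    rw [PowerSeries.coeff_map, PowerSeries.coeff_mk, posPartY, PowerSeries.coeff_mk,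
      PowerSeries.coeff_mk, posPart, map_sum]
    refine Finset.sum_congr rfl fun j hj => ?_
    have hj0 := (Finset.mem_filter.1 hj).2
    rw [hf n j hj0, polyYToLaurentY, RingHom.comp_apply, Polynomial.coe_mapRingHom,
      Polynomial.map_monomial, ← Polynomial.C_mul_X_pow_eq_monomial,
      Polynomial.toLaurent_C_mul_X_pow, Int.toNat_of_nonneg hj0.le]
  · refine PowerSeries.ext fun n => Polynomial.ext fun k => LaurentPolynomial.ext fun i => ?_
    have h0 : posPart (0 : LaurentX) = 0 := LaurentPolynomial.ext fun i => by
      rw [coeff_posPart]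
      exact ite_self _
    have h1 : (∑ j ∈ (f n).coeff.support with 0 < j,
        Polynomial.monomial j.toNat (p n j)).coeff k = if 1 ≤ k then p n k else 0 := by
      rw [Polynomial.finsetSum_coeff]
      simp only [Polynomial.coeff_monomial]
      split_ifs with hk
      · rw [Finset.sum_eq_single (k : ℤ)]
        · rw [Int.toNat_natCast, if_pos rfl]
        · intro j hj hjk
          rw [if_neg]
          have := (Finset.mem_filter.1 hj).2
          omega
        · intro hj
          have h2 : (f n).coeff k = 0 := by
            by_contra h3
            exact hj (Finset.mem_filter.2 ⟨Finsupp.mem_support_iff.2 h3, by omega⟩)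
          rw [hf n k (by omega), map_eq_zero_iff _ laurentXToQx_injective] at h2
          rw [h2, ite_self]
      · refine Finset.sum_eq_zero fun j hj => if_neg ?_
        have := (Finset.mem_filter.1 hj).2
        omega
    rw [coeff_xyQ h, posPartX, PowerSeries.coeff_mk, PowerSeries.coeff_mk,
      coeff_sum_monomial _ h0, coeff_posPart, h1]
    by_cases hk : 1 ≤ k
    · by_cases hi : 1 ≤ i
      · rw [if_pos ⟨hi, hk⟩, if_pos hk, if_pos (by omega), ← hp,
          show ((k - 1 : ℕ) : ℤ) + 1 = k by omega, show ((i - 1).toNat : ℤ) + 1 = i by omega]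
      · rw [if_neg (by omega), if_neg (by omega)]
    · rw [if_neg (by omega), if_neg hk]
      exact (ite_self _).symm

end PositiveParts

end QuarterPlane
end

/-! ### The proposition -/

theorem mainTheorem2 (𝒮 : Finset (ℤ × ℤ)) (h𝒮 : 𝒮 ∈ QuarterPlane.finiteGroupModels)
    (hK : 𝒮 ≠ QuarterPlane.kreweras) (hRK : 𝒮 ≠ QuarterPlane.reverseKreweras)
    (hDK : 𝒮 ≠ QuarterPlane.doubleKreweras) (hG : 𝒮 ≠ QuarterPlane.gessel) :
    Finite (QuarterPlane.group 𝒮) ∧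
    (∃ F : PowerSeries QuarterPlane.LaurentY,
      QuarterPlane.IsExpansion (QuarterPlane.R 𝒮) F ∧
      ∃ Rplus : PowerSeries QuarterPlane.LaurentXPolyY,
        PowerSeries.map QuarterPlane.polyYToLaurentY Rplus = QuarterPlane.posPartY F ∧
        QuarterPlane.xyQ 𝒮 = QuarterPlane.posPartX Rplus) ∧
    QuarterPlane.IsDFinite (QuarterPlane.Q 𝒮) ∧
    ∀ i j n : ℕ, (QuarterPlane.q 𝒮 i j n : ℚ) =
      QuarterPlane.coeffXY (i + 1) (j + 1)
        (QuarterPlane.orbitSum 𝒮 * QuarterPlane.stepPoly 𝒮 ^ n) := by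
  obtain ⟨hfin, o, p, ho, hp, hq⟩ := QuarterPlane.exists_halfPlanePoly h𝒮 hK hRK hDK hG
  have h := (QuarterPlane.models_symm 𝒮 (by simp [h𝒮, hK, hRK, hDK, hG])).1
  have hcoeff : ∀ i j n : ℕ, (QuarterPlane.q 𝒮 i j n : ℚ) =
      QuarterPlane.coeffXY (i + 1) (j + 1)
        (QuarterPlane.orbitSum 𝒮 * QuarterPlane.stepPoly 𝒮 ^ n) := fun i j n => by
    rw [← ho, ← QuarterPlane.laurentYToQxy_stepLaurent, ← map_pow, ← map_mul,
      QuarterPlane.coeffXY_laurentYToQxy _ (hp n (j + 1) (by omega)), hq]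
  refine ⟨hfin, ⟨_, ?_, QuarterPlane.exists_positive_part h hp hq⟩, ?_, hcoeff⟩
  · rw [QuarterPlane.R, QuarterPlane.kernel, ← ho, ← QuarterPlane.laurentYToQxy_stepLaurent]
    exact QuarterPlane.isExpansion_geometric o _
  · have hQ : QuarterPlane.Q 𝒮 = fun m => QuarterPlane.coeffXY (m 0 + 1) (m 1 + 1)
        (QuarterPlane.orbitSum 𝒮 * QuarterPlane.stepPoly 𝒮 ^ m 2) :=
      funext fun m => hcoeff (m 0) (m 1) (m 2)
    rw [hQ]
    exact QuarterPlane.isDFinite_coeffXY _ _
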